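/- Let $\ell,m\ge 1$, let $\Sigma=\{a_1,\dots,a_\ell,b\}$ be an alphabet, and let $\xi,\eta\in[0,\infty)^m$, $A_1,\dots,A_\ell,B\in[0,\infty)^{m\times m}$, where all $A_i$ and $B$ are non-zero. Let $\mu$ be the monoid morphism on $\Sigma^*$ with $\mu(a_i)=A_i$, $\mu(b)=B$, and put $(r,w)=\xi'\mu(w)\eta$ for $w\in\Sigma^*$ (a prime on a vector denotes transposition). Assume that for every large $n$ some word $w$ of length $n$ has $(r,w)>0$. For such $n$ let $\mathbf Y_n=(Y_{n,1},\dots,Y_{n,\ell})$, where $Y_{n,i}=|w|_{a_i}$ is the number of occurrences of $a_i$ in a word $w\in\Sigma^n$ drawn at random with probability $(r,w)/\sum_{x\in\Sigma^n}(r,x)$. Assume that $M=A_1+\dots+A_\ell+B$ is primitive, with Perron–Frobenius eigenvalue $\lambda$. For $\mathbf t\in\mathbb R^\ell$ let $M(\mathbf t)=A_1e^{t_1}+\dots+A_\ell e^{t_\ell}+B$ and let $y(\mathbf t)$ be its Perron–Frobenius eigenvalue. Then $y$ is positive and real analytic on $\mathbb R^\ell$, $\det(y(\mathbf t)I-M(\mathbf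 t))=0$ for all $\mathbf t$, and $y(\mathbf 0)=\lambda$. For every $\mathbf t$ there are strictly positive right and left eigenvectors $u_{\mathbf t}$, $v_{\mathbf t}'$ of $M(\mathbf t)$ relative to $y(\mathbf t)$ with $v_{\mathbf t}'u_{\mathbf t}=1$. For every choice of them, with $u=u_{\mathbf 0}$ and $v=v_{\mathbf 0}$, the function $$r(\mathbf t)=\frac{\xi'u_{\mathbf t}\,v_{\mathbf t}'\eta}{\xi'u\,v'\eta}$$ is positive and real analytic on $\mathbb R^\ell$ with $r(\mathbf 0)=1$. Put $\boldsymbol\beta=\nabla y(\mathbf 0)/\lambda$, $\mathbf c=\nabla r(\mathbf 0)$, and let $\Gamma=[\gamma_{ij}]$ and $C=[c_{ij}]$ be the Hessian matrices at $\mathbf 0$ of $\log y$ and $\log r$. Then the following hold. 1. For every $i$, $\beta_i=v'A_iu/\lambda$ and $0<\beta_i<1$; moreover $0<\sum_{i=1}^\ell\beta_i<1$. 2. For all $i,j$, $$\gamma_{ij}=\frac{\partial_{ij}y(\mathbf 0)}{\lambda}-\frac{\partial_iy(\mathbf 0)\,\partial_jy(\mathbf 0)}{\lambda^2},\qquad c_{ij}=\partial_{ij}r(\mathbf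 0)-\partial_ir(\mathbf 0)\,\partial_jr(\mathbf 0),$$ and $\gamma_{ii}>0$. 3. There is $\varepsilon\in(0,1)$ such that, componentwise as $n\to\infty$, $$\mathbb E[\mathbf Y_n]=\boldsymbol\beta n+\mathbf c+O(\varepsilon^n),\qquad \mathrm{Cov}(\mathbf Y_n)=n\Gamma+C+O(\varepsilon^n).$$ 4. $\mathrm{Var}(Y_{n,i})=\Theta(n)$ for every $i$, and $\mathrm{Cov}(Y_{n,i}/\sqrt n,\,Y_{n,j}/\sqrt n)\to\gamma_{ij}$ as $n\to\infty$ for all $i,j$. -/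

import Mathlib

open Filter Topology MeasureTheory ProbabilityTheory Asymptotics
open scoped Matrix

noncomputable section

namespace RationalModel

/-- The alphabet of `ℓ + 1` letters: `some i` is the letter `a_i` and `none` is the letter `b`. -/
abbrev Letter (ℓ : ℕ) : Type := Option (Fin ℓ)

/-- Words of length `n` over the alphabet. -/
def Word (ℓ n : ℕ) : Type := Fin n → Letter ℓ

instance (ℓ n : ℕ) : Fintype (Word ℓ n) := inferInstanceAs (Fintype (Fin n → Letter ℓ))

instance (ℓ n : ℕ) : MeasurableSpace (Word ℓ n) := ⊤

/-- The number of occurrences of the letter `x` in a word. -/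
def Word.count {ℓ n : ℕ} (w : Word ℓ n) (x : Letter ℓ) : ℕ :=
  (List.ofFn (show Fin n → Letter ℓ from w)).count x

/-- A linear representation `(ξ, μ, η)` of size `m`, where `μ` is the monoid morphism
with `μ(a_i) = A i` and `μ(b) = B`. All weights are nonnegative and
all the matrices `A i` and `B` are nonzero. -/
structure LinearRepresentation (ℓ m : ℕ) where
  ξ : Fin m → ℝ
  η : Fin m → ℝ
  A : Fin ℓ → Matrix (Fin m) (Fin m) ℝ
  B : Matrix (Fin m) (Fin m) ℝ
  ξ_nonneg : ∀ p, 0 ≤ ξ p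
  η_nonneg : ∀ p, 0 ≤ η p
  A_nonneg : ∀ i p q, 0 ≤ A i p q
  B_nonneg : ∀ p q, 0 ≤ B p q
  A_ne_zero : ∀ i, A i ≠ 0
  B_ne_zero : B ≠ 0

namespace LinearRepresentation

variable {ℓ m : ℕ} (R : LinearRepresentation ℓ m)

/-- The matrix of a letter. -/
def letterMatrix : Letter ℓ → Matrix (Fin m) (Fin m) ℝ
  | some i => R.A i
  | none => R.B

/-- The matrix `μ(w) = μ(w_1) ⋯ μ(w_n)` of a word `w = w_1 ⋯ w_n`. -/
def wordMatrix {n : ℕ} (w : Word ℓ n) : Matrix (Fin m) (Fin m) ℝ :=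
  (List.ofFn fun k => R.letterMatrix (w k)).prod

/-- The value `(r, w) = ξ' μ(w) η` of the rational series at the word `w`. -/
def series {n : ℕ} (w : Word ℓ n) : ℝ := R.ξ ⬝ᵥ (R.wordMatrix w *ᵥ R.η)

/-- The sum of the values of the series on all words of length `n`. -/
def totalWeight (n : ℕ) : ℝ := ∑ w : Word ℓ n, R.series w

/-- The probability `Pr(w) = (r, w) / ∑ x, (r, x)` of a word of length `n`. -/
def prob {n : ℕ} (w : Word ℓ n) : ℝ := R.series w / R.totalWeight n

/-- The measure on the words of length `n` that gives mass `Pr(w)` to each word `w`. -/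
def wordMeasure (n : ℕ) : Measure (Word ℓ n) :=
  ∑ w : Word ℓ n, ENNReal.ofReal (R.prob w) • Measure.dirac w

/-- The random vector `Y_n`: its `i`-th component is the number of occurrences of `a_i`
in a word of length `n`. -/
def Y (_R : LinearRepresentation ℓ m) (n : ℕ) (i : Fin ℓ) (w : Word ℓ n) : ℝ :=
  (w.count (some i) : ℝ)

/-- `M(t) = A_1 e^{t_1} + ⋯ + A_ℓ e^{t_ℓ} + B`. -/
def Mt (t : Fin ℓ → ℝ) : Matrix (Fin m) (Fin m) ℝ :=
  ∑ i, Real.exp (t i) • R.A i + R.B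

/-- `M = A_1 + ⋯ + A_ℓ + B`. -/
def M : Matrix (Fin m) (Fin m) ℝ := ∑ i, R.A i + R.B

end LinearRepresentation

/-- The Perron-Frobenius eigenvalue of a primitive matrix: its (unique) eigenvalue of largest
modulus is real and positive, hence equal to the spectral radius over `ℂ`. -/
def perronRoot {m : ℕ} (T : Matrix (Fin m) (Fin m) ℝ) : ℝ :=
  (spectralRadius ℂ (T.map Complex.ofReal)).toReal

/-- `u` and `v'` are strictly positive right and left eigenvectors of `T` for its
Perron-Frobenius eigenvalue, normalized by `v' u = 1`. -/
structure IsPerronPair {m : ℕ} (T : Matrix (Fin m) (Fin m) ℝ) (u v : Fin m → ℝ) : Prop where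
  right_pos : ∀ p, 0 < u p
  left_pos : ∀ p, 0 < v p
  right_eigen : T *ᵥ u = perronRoot T • u
  left_eigen : v ᵥ* T = perronRoot T • v
  normalized : v ⬝ᵥ u = 1

/-- The partial derivative `∂ f / ∂ t_i`. -/
def partialDeriv {ℓ : ℕ} (i : Fin ℓ) (f : (Fin ℓ → ℝ) → ℝ) (t : Fin ℓ → ℝ) : ℝ :=
  lineDeriv ℝ f t (Pi.single i 1)

/-- The Hessian matrix `[∂² f / ∂ t_i ∂ t_j]` of `f` at `t`. -/
def hessian {ℓ : ℕ} (f : (Fin ℓ → ℝ) → ℝ) (t : Fin ℓ → ℝ) : Matrix (Fin ℓ) (Fin ℓ) ℝ :=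
  Matrix.of fun i j => partialDeriv i (partialDeriv j f) t

namespace LinearRepresentation

variable {ℓ m : ℕ} (R : LinearRepresentation ℓ m)

/-- `y(t)`, the Perron-Frobenius eigenvalue of `M(t)`. -/
def y (t : Fin ℓ → ℝ) : ℝ := perronRoot (R.Mt t)

/-- `r(t) = (ξ' u_t v_t' η) / (ξ' u_0 v_0' η)`, for given families of right and left
Perron-Frobenius eigenvectors `u_t`, `v_t'` of `M(t)`. -/
def r (u v : (Fin ℓ → ℝ) → Fin m → ℝ) (t : Fin ℓ → ℝ) : ℝ :=
  (R.ξ ⬝ᵥ u t) * (v t ⬝ᵥ R.η) / ((R.ξ ⬝ᵥ u 0) * (v 0 ⬝ᵥ R.η))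

/-- `β = ∇ y(0) / λ`, where `λ` is the Perron-Frobenius eigenvalue of `M`. -/
def β (i : Fin ℓ) : ℝ := partialDeriv i R.y 0 / perronRoot R.M

/-- `c = ∇ r(0)`. -/
def c (u v : (Fin ℓ → ℝ) → Fin m → ℝ) (i : Fin ℓ) : ℝ := partialDeriv i (R.r u v) 0

/-- `Γ`, the Hessian of `log y` at `0`. -/
def Γ : Matrix (Fin ℓ) (Fin ℓ) ℝ := hessian (fun t => Real.log (R.y t)) 0

/-- `C`, the Hessian of `log r` at `0`. -/
def C (u v : (Fin ℓ → ℝ) → Fin m → ℝ) : Matrix (Fin ℓ) (Fin ℓ) ℝ :=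
  hessian (fun t => Real.log (R.r u v t)) 0

theorem letterMatrix_nonneg (x : Letter ℓ) (p q : Fin m) : 0 ≤ R.letterMatrix x p q := by
  cases x with
  | none => exact R.B_nonneg p q
  | some i => exact R.A_nonneg i p q

theorem list_prod_nonneg (L : List (Matrix (Fin m) (Fin m) ℝ))
    (hL : ∀ T ∈ L, ∀ p q, 0 ≤ T p q) (p q : Fin m) : 0 ≤ L.prod p q := by
  induction L generalizing p q with
  | nil => simp only [List.prod_nil, Matrix.one_apply]; split_ifs <;> norm_num
  | cons T L ih =>
    rw [List.prod_cons, Matrix.mul_apply]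
    exact Finset.sum_nonneg fun k _ => mul_nonneg (hL T (by simp) p k)
      (ih (fun S hS => hL S (by simp [hS])) k q)

theorem series_nonneg {n : ℕ} (w : Word ℓ n) : 0 ≤ R.series w := by
  unfold series
  refine Finset.sum_nonneg fun p _ => mul_nonneg (R.ξ_nonneg p) ?_
  rw [Matrix.mulVec, dotProduct]
  refine Finset.sum_nonneg fun q _ => mul_nonneg ?_ (R.η_nonneg q)
  refine list_prod_nonneg _ (fun T hT p q => ?_) p q
  obtain ⟨k, rfl⟩ := (List.mem_ofFn' _ _).1 hT
  exact R.letterMatrix_nonneg _ p q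

/-- As soon as some word of length `n` has positive weight, the model is a probability. -/
theorem isProbabilityMeasure_wordMeasure {n : ℕ} (h : ∃ w : Word ℓ n, 0 < R.series w) :
    IsProbabilityMeasure (R.wordMeasure n) := by
  have ht : 0 < R.totalWeight n := by
    obtain ⟨w, hw⟩ := h
    exact Finset.sum_pos' (fun w _ => R.series_nonneg w) ⟨w, Finset.mem_univ w, hw⟩
  refine ⟨?_⟩
  simp only [wordMeasure, Measure.finsetSum_apply, Measure.smul_apply, measure_univ, smul_eq_mul,
    mul_one]
  have hp : ∀ w ∈ (Finset.univ : Finset (Word ℓ n)), 0 ≤ R.prob w :=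
    fun w _ => div_nonneg (R.series_nonneg w) ht.le
  rw [← ENNReal.ofReal_sum_of_nonneg hp]
  simp only [prob, ← Finset.sum_div]
  rw [← totalWeight, div_self ht.ne', ENNReal.ofReal_one]

end LinearRepresentation

end RationalModel

end

/-! Giving the letter `a_i` the weight `e^{t_i}` turns the sum of all letter matrices into `M(t)`,
so `ξ' M(t)^n η` is the unnormalized moment generating function of `Y_n`
(`sum_exp_smul_wordMatrix`). Means and covariances are its logarithmic derivatives at `0`. The
projection `P_t = u_t v_t'` is idempotent and `M(t) P_t = P_t M(t) = y(t) P_t`. Hence `M(t)^n =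
y(t)^n P_t + (M(t) - y(t) P_t)^n` for `n > 0`, and after division by `λ^n ξ'u v'η` the generating
function becomes a quasi-power `(y(t)/λ)^n r(t) + E_n(t)` (`genFun_eq`). At `0` the remainder `E_n`
and its derivatives of order at most two are exponentially small (`exists_geometric_bound`,
`expSmall_bilinear`). So the logarithm behaves like `n log (y/λ) + log r` up to second order at `0`,
which gives the mean and the covariance (`expSmall_quasiPower`). Analyticity comes from the implicit
function theorem applied to `T x = c x`, `a'x = 1`, whose Jacobian is invertible because the
Perron-Frobenius eigenvalue is simple (`contDiff_perron`). For `γ_ii > 0`, differentiating the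
eigenvalue equation twice expresses `λ γ_ii` through the derivative `w` of a normalized right
eigenvector, and the result is a weighted sum of squares of martingale increments
(`sum_sq_increments`). If it vanished, the number of `a_i` along every path of positive weight would
be `nβ_i` plus a coboundary. Primitivity supplies closed paths of consecutive lengths at one state,
so `β_i` would be an integer, against `0 < β_i < 1` (`not_coboundary`). -/

open scoped ContDiff

noncomputable section

namespace RationalModel

/-! ### Perron-Frobenius theory of primitive matrices and analytic dependence on parameters. -/

section Perron

variable {m : ℕ} {T : Matrix (Fin m) (Fin m) ℝ}

theorem mulVec_pos (hT : ∀ p q, 0 < T p q) {x : Fin m → ℝ} (hx : ∀ p, 0 ≤ x p) (hx0 : x ≠ 0)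
    (p : Fin m) : 0 < (T *ᵥ x) p := by
  obtain ⟨q, hq⟩ := Function.ne_iff.1 hx0
  exact Finset.sum_pos' (fun r _ => mul_nonneg (hT p r).le (hx r))
    ⟨q, Finset.mem_univ q, mul_pos (hT p q) (lt_of_le_of_ne (hx q) (Ne.symm hq))⟩

theorem dotProduct_pos {v x : Fin m → ℝ} (hv : ∀ p, 0 < v p) (hx : ∀ p, 0 ≤ x p) (hx0 : x ≠ 0) :
    0 < v ⬝ᵥ x := by
  obtain ⟨q, hq⟩ := Function.ne_iff.1 hx0
  exact Finset.sum_pos' (fun r _ => mul_nonneg (hv r).le (hx r))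
    ⟨q, Finset.mem_univ q, mul_pos (hv q) (lt_of_le_of_ne (hx q) (Ne.symm hq))⟩

theorem pow_mulVec_eigenvector {x : Fin m → ℝ} {c : ℝ} (h : T *ᵥ x = c • x) (k : ℕ) :
    T ^ k *ᵥ x = c ^ k • x := by
  induction k with
  | zero => simp
  | succ k ih => rw [pow_succ, ← Matrix.mulVec_mulVec, h, Matrix.mulVec_smul, ih, smul_smul,
      pow_succ, mul_comm]

theorem exists_pos_mul_le {z w : Fin m → ℝ} (hz : ∀ p, 0 < z p) (hw : ∀ p, 0 < w p) :
    ∃ ε > 0, ∀ p, ε * z p ≤ w p := by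
  rcases isEmpty_or_nonempty (Fin m) with h | h
  · exact ⟨1, one_pos, fun p => h.elim p⟩
  · obtain ⟨p, hp⟩ := Finite.exists_min fun p => w p / z p
    exact ⟨w p / z p, div_pos (hw p) (hz p), fun q => (le_div_iff₀ (hz q)).1 (hp q)⟩

/-- Collatz-Wielandt argument: the largest `c` with `c x ≤ T x` for some `x` in the simplex is
attained by compactness, and at a maximum the inequality is an equality. -/
theorem exists_pos_eigenvector [NeZero m] (hT : T.IsPrimitive) :
    ∃ c > (0 : ℝ), ∃ u : Fin m → ℝ, (∀ p, 0 < u p) ∧ T *ᵥ u = c • u := by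
  obtain ⟨hT0, k, hk0, hk⟩ := hT
  let K : Set (ℝ × (Fin m → ℝ)) :=
    {z | 0 ≤ z.1 ∧ (∀ p, 0 ≤ z.2 p) ∧ ∑ p, z.2 p = 1 ∧ ∀ p, z.1 * z.2 p ≤ (T *ᵥ z.2) p}
  have hKclosed : IsClosed K := by
    have hcont : ∀ p, Continuous fun z : ℝ × (Fin m → ℝ) => (T *ᵥ z.2) p := fun p => by
      unfold Matrix.mulVec dotProduct
      fun_prop
    refine (isClosed_le continuous_const continuous_fst).inter (IsClosed.inter ?_
      (IsClosed.inter (isClosed_eq (by fun_prop) continuous_const) ?_))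
    · change IsClosed {z : ℝ × (Fin m → ℝ) | ∀ p, 0 ≤ z.2 p}
      simp only [Set.ofPred_forall]
      exact isClosed_iInter fun p => isClosed_le continuous_const (by fun_prop)
    · change IsClosed {z : ℝ × (Fin m → ℝ) | ∀ p, z.1 * z.2 p ≤ (T *ᵥ z.2) p}
      simp only [Set.ofPred_forall]
      exact isClosed_iInter fun p => isClosed_le (by fun_prop) (hcont p)
  have hKcompact : IsCompact K := by
    refine (isCompact_Icc (a := ((0 : ℝ), (0 : Fin m → ℝ)))
      (b := (∑ p, ∑ q, T p q, fun _ => 1))).of_isClosed_subset hKclosed ?_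
    rintro ⟨c, x⟩ ⟨hc, hx, hsum, hle⟩
    have hx1 : ∀ p, x p ≤ 1 := fun p =>
      hsum ▸ Finset.single_le_sum (fun q _ => hx q) (Finset.mem_univ p)
    refine ⟨⟨hc, hx⟩, ⟨?_, hx1⟩⟩
    -- Summing `c x ≤ T x` over the simplex bounds `c` by the sum of the entries of `T`.
    calc c = ∑ p, c * x p := by rw [← Finset.mul_sum]; simp only at hsum; rw [hsum, mul_one]
      _ ≤ ∑ p, (T *ᵥ x) p := Finset.sum_le_sum fun p _ => hle p
      _ ≤ ∑ p, ∑ q, T p q := Finset.sum_le_sum fun p _ => by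
          unfold Matrix.mulVec dotProduct
          exact Finset.sum_le_sum fun q _ => mul_le_of_le_one_right (hT0 p q) (hx1 q)
  have hKne : K.Nonempty := by
    refine ⟨(0, Pi.single 0 1), le_rfl, fun p => ?_, by simp, fun p => ?_⟩
    · exact (Pi.single_nonneg (i := (0 : Fin m)) (α := fun _ => ℝ)).2 zero_le_one p
    · simpa using hT0 p 0
  obtain ⟨⟨c, x⟩, ⟨hc, hx, hsum, hle⟩, hmax⟩ :=
    hKcompact.exists_isMaxOn hKne continuous_fst.continuousOn
  simp only at hc hx hsum hle
  have hx0 : x ≠ 0 := by rintro rfl; simp at hsum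
  have hz := mulVec_pos hk hx hx0
  have heig : T *ᵥ x = c • x := by
    -- Applying `T ^ k` makes the nonzero slack `T x - c x` strictly positive, so `z = T ^ k x`
    -- leaves room to replace `c` by `c + ε`.
    by_contra hne
    have hd := mulVec_pos hk (x := T *ᵥ x - c • x)
      (fun p => by simpa using hle p) (sub_ne_zero.2 hne)
    obtain ⟨ε, hε, hεle⟩ := exists_pos_mul_le hz hd
    set z := T ^ k *ᵥ x with hzdef
    have hcomm : T ^ k *ᵥ (T *ᵥ x - c • x) = T *ᵥ z - c • z := by
      rw [Matrix.mulVec_sub, Matrix.mulVec_smul, hzdef, Matrix.mulVec_mulVec,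
        Matrix.mulVec_mulVec, ← pow_succ, ← pow_succ']
    have hS : 0 < ∑ p, z p := Finset.sum_pos (fun p _ => hz p) ⟨0, Finset.mem_univ _⟩
    have hmem : (c + ε, (∑ p, z p)⁻¹ • z) ∈ K := by
      refine ⟨by positivity, fun p => ?_, ?_, fun p => ?_⟩
      · exact mul_nonneg (inv_nonneg.2 hS.le) (hz p).le
      · simp [← Finset.mul_sum, hS.ne']
      · have h1 := hεle p
        rw [hcomm] at h1
        simp only [Pi.sub_apply, Pi.smul_apply, smul_eq_mul, Matrix.mulVec_smul] at h1 ⊢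
        have h2 : (c + ε) * z p ≤ (T *ᵥ z) p := by linarith
        calc (c + ε) * ((∑ p, z p)⁻¹ * z p) = (∑ p, z p)⁻¹ * ((c + ε) * z p) := by ring
          _ ≤ _ := mul_le_mul_of_nonneg_left h2 (inv_nonneg.2 hS.le)
    have := hmax hmem
    simp only [Set.mem_ofPred_eq] at this
    linarith
  -- Now `T ^ k x = c ^ k x` has positive entries, which forces `x > 0` and, since `k > 0`, also `c
  -- ≠ 0`.
  rw [pow_mulVec_eigenvector heig] at hz
  have hck : ∀ p, 0 < c ^ k * x p := hz
  have hxpos : ∀ p, 0 < x p := fun p => pos_of_mul_pos_right (hck p) (pow_nonneg hc k)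
  refine ⟨c, ?_, x, hxpos, heig⟩
  refine lt_of_le_of_ne hc fun h0 => ?_
  have := hck 0
  rw [← h0, zero_pow hk0.ne', zero_mul] at this
  exact this.false

theorem eigenvalue_eq {u v : Fin m → ℝ} {c c' : ℝ} (hu : ∀ p, 0 < u p) (hv : ∀ p, 0 < v p)
    [NeZero m] (hTu : T *ᵥ u = c • u) (hTv : v ᵥ* T = c' • v) : c = c' := by
  have h1 : v ⬝ᵥ (T *ᵥ u) = (v ᵥ* T) ⬝ᵥ u := Matrix.dotProduct_mulVec v T u
  rw [hTu, hTv, dotProduct_smul, smul_dotProduct, smul_eq_mul, smul_eq_mul] at h1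
  have h2 : 0 < v ⬝ᵥ u := dotProduct_pos hv (fun p => (hu p).le)
    (fun h => (hu 0).ne' (congrFun h 0))
  exact mul_right_cancel₀ h2.ne' h1

theorem map_ofReal_mulVec_apply (x : Fin m → ℝ) (p : Fin m) :
    (T.map Complex.ofReal *ᵥ fun q => (x q : ℂ)) p = ((T *ᵥ x) p : ℂ) := by
  simp [Matrix.mulVec, dotProduct]

theorem mem_spectrum_iff_exists_mulVec {S : Matrix (Fin m) (Fin m) ℂ} {z : ℂ} :
    z ∈ spectrum ℂ S ↔ ∃ x : Fin m → ℂ, x ≠ 0 ∧ S *ᵥ x = z • x := by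
  rw [← Matrix.spectrum_toLin', ← Module.End.hasEigenvalue_iff_mem_spectrum]
  constructor
  · rintro h
    obtain ⟨x, hx⟩ := h.exists_hasEigenvector
    exact ⟨x, hx.2, by simpa using hx.apply_eq_smul⟩
  · rintro ⟨x, hx0, hx⟩
    exact Module.End.hasEigenvalue_of_hasEigenvector
      ⟨Module.End.mem_eigenspace_iff.2 (by simpa using hx), hx0⟩

/-- A complex eigenvector `x` for `z` satisfies `|z| |x| ≤ T |x|` entrywise; pairing with the
positive left eigenvector gives `|z| ≤ c`. The bound is attained because `c` is itself an
eigenvalue. -/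
theorem perronRoot_eq [NeZero m] (hT : ∀ p q, 0 ≤ T p q) {u v : Fin m → ℝ} {c : ℝ}
    (hu : ∀ p, 0 < u p) (hv : ∀ p, 0 < v p) (hTu : T *ᵥ u = c • u) (hTv : v ᵥ* T = c • v) :
    perronRoot T = c := by
  have hc : 0 ≤ c := by
    have h1 : 0 ≤ (T *ᵥ u) 0 := by
      unfold Matrix.mulVec dotProduct
      exact Finset.sum_nonneg fun q _ => mul_nonneg (hT 0 q) (hu q).le
    rw [hTu] at h1
    exact nonneg_of_mul_nonneg_left h1 (hu 0)
  have key : spectralRadius ℂ (T.map Complex.ofReal) = ENNReal.ofReal c := by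
    refine le_antisymm (iSup₂_le fun z hz => ?_) ?_
    · obtain ⟨x, hx0, hx⟩ := mem_spectrum_iff_exists_mulVec.1 hz
      have h1 : ∀ p, ‖z‖ * ‖x p‖ ≤ (T *ᵥ fun q => ‖x q‖) p := fun p => by
        have h2 := congrFun hx p
        rw [Pi.smul_apply, smul_eq_mul] at h2
        rw [← norm_mul, ← h2]
        unfold Matrix.mulVec dotProduct
        refine (norm_sum_le _ _).trans (Finset.sum_le_sum fun q _ => ?_)
        simp [abs_of_nonneg (hT p q)]
      have h3 : ‖z‖ * (v ⬝ᵥ fun q => ‖x q‖) ≤ c * (v ⬝ᵥ fun q => ‖x q‖) := by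
        calc ‖z‖ * (v ⬝ᵥ fun q => ‖x q‖) = ∑ p, v p * (‖z‖ * ‖x p‖) := by
              rw [dotProduct, Finset.mul_sum]; exact Finset.sum_congr rfl fun p _ => by ring
          _ ≤ v ⬝ᵥ (T *ᵥ fun q => ‖x q‖) :=
              Finset.sum_le_sum fun p _ => mul_le_mul_of_nonneg_left (h1 p) (hv p).le
          _ = c * (v ⬝ᵥ fun q => ‖x q‖) := by
              rw [Matrix.dotProduct_mulVec, hTv, smul_dotProduct, smul_eq_mul]
      have h4 : 0 < v ⬝ᵥ fun q => ‖x q‖ := dotProduct_pos hv (fun p => norm_nonneg _)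
        (fun h => hx0 (funext fun p => norm_eq_zero.1 (congrFun h p)))
      have h5 := le_of_mul_le_mul_right h3 h4
      rw [← enorm_eq_nnnorm, ← ofReal_norm]
      exact ENNReal.ofReal_le_ofReal h5
    · have hmem : (c : ℂ) ∈ spectrum ℂ (T.map Complex.ofReal) := by
        refine mem_spectrum_iff_exists_mulVec.2 ⟨fun q => (u q : ℂ), fun h => ?_, funext fun p => ?_⟩
        · exact (hu 0).ne' (Complex.ofReal_eq_zero.1 (congrFun h 0))
        · rw [map_ofReal_mulVec_apply, hTu]
          simp
      refine le_trans (le_of_eq ?_) (le_iSup₂ (α := ENNReal) (c : ℂ) hmem)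
      rw [← enorm_eq_nnnorm, ← ofReal_norm]
      simp [abs_of_nonneg hc]
  rw [perronRoot, key, ENNReal.toReal_ofReal hc]

theorem isPrimitive_transpose (hT : T.IsPrimitive) : Tᵀ.IsPrimitive := by
  obtain ⟨h0, k, hk0, hk⟩ := hT
  refine ⟨fun p q => h0 q p, k, hk0, fun p q => ?_⟩
  rw [← Matrix.transpose_pow]
  exact hk q p

/-- Existence of normalized Perron-Frobenius eigenvectors. -/
theorem exists_isPerronPair [NeZero m] (hT : T.IsPrimitive) :
    0 < perronRoot T ∧ ∃ u v, IsPerronPair T u v := by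
  obtain ⟨c, hc, u, hu, hTu⟩ := exists_pos_eigenvector hT
  obtain ⟨c', -, v, hv, hTv⟩ := exists_pos_eigenvector (isPrimitive_transpose hT)
  rw [Matrix.mulVec_transpose] at hTv
  obtain rfl := eigenvalue_eq hu hv hTu hTv
  have hp := perronRoot_eq hT.nonneg hu hv hTu hTv
  have h2 : 0 < v ⬝ᵥ u := dotProduct_pos hv (fun p => (hu p).le)
    (fun h => (hu 0).ne' (congrFun h 0))
  refine ⟨hp ▸ hc, u, (v ⬝ᵥ u)⁻¹ • v, hu, fun p => mul_pos (inv_pos.2 h2) (hv p), hp ▸ hTu, ?_, ?_⟩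
  · rw [Matrix.smul_vecMul, hTv, hp, smul_comm]
  · rw [smul_dotProduct, smul_eq_mul, inv_mul_cancel₀ h2.ne']

theorem perronRoot_eq_of_eigenvector [NeZero m] (hT : T.IsPrimitive) {u : Fin m → ℝ} {c : ℝ}
    (hu : ∀ p, 0 < u p) (hTu : T *ᵥ u = c • u) : perronRoot T = c := by
  obtain ⟨-, u', v', h⟩ := exists_isPerronPair hT
  exact (eigenvalue_eq hu h.left_pos hTu h.left_eigen).symm

theorem perronRoot_transpose [NeZero m] (hT : T.IsPrimitive) :
    perronRoot Tᵀ = perronRoot T := by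
  obtain ⟨-, u', v', h⟩ := exists_isPerronPair hT
  exact perronRoot_eq_of_eigenvector (isPrimitive_transpose hT) h.left_pos
    (by rw [Matrix.mulVec_transpose, h.left_eigen])

/-- Subtract from `x` the largest multiple of `u` lying below it. The difference is a nonnegative
eigenvector with a zero coordinate; were it nonzero, a positive power of `T` would make that
coordinate positive. -/
theorem exists_eq_smul_of_eigenvector [NeZero m] (hT : T.IsPrimitive) {u x : Fin m → ℝ} {c : ℝ}
    (hu : ∀ p, 0 < u p) (hTu : T *ᵥ u = c • u) (hTx : T *ᵥ x = c • x) : ∃ a : ℝ, x = a • u := by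
  obtain ⟨p₀, hp₀⟩ := Finite.exists_min fun p => x p / u p
  set a := x p₀ / u p₀ with ha
  refine ⟨a, ?_⟩
  by_contra hne
  obtain ⟨-, k, -, hk⟩ := hT
  have hd : T *ᵥ (x - a • u) = c • (x - a • u) := by
    rw [Matrix.mulVec_sub, Matrix.mulVec_smul, hTu, hTx, smul_sub, smul_comm]
  have h1 := mulVec_pos hk (x := x - a • u) (fun p => by
    have := (le_div_iff₀ (hu p)).1 (hp₀ p)
    simpa using this) (sub_ne_zero.2 hne) p₀
  rw [pow_mulVec_eigenvector hd] at h1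
  simp [ha, (hu p₀).ne'] at h1

theorem eigenvector_unique [NeZero m] (hT : T.IsPrimitive) {a u x : Fin m → ℝ} {c c' : ℝ}
    (hu : ∀ p, 0 < u p) (hTu : T *ᵥ u = c • u) (hx : ∀ p, 0 < x p) (hTx : T *ᵥ x = c' • x)
    (h1 : a ⬝ᵥ u = 1) (h2 : a ⬝ᵥ x = 1) : x = u := by
  have hcc : c' = c := by
    rw [← perronRoot_eq_of_eigenvector hT hu hTu, perronRoot_eq_of_eigenvector hT hx hTx]
  obtain ⟨b, rfl⟩ := exists_eq_smul_of_eigenvector hT hu hTu (hcc ▸ hTx)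
  rw [dotProduct_smul, h1, smul_eq_mul, mul_one] at h2
  rw [h2, one_smul]

/-- The eigenvalue equation `T x = c x` with the normalization `a ⬝ᵥ x = 1`, as a zero set. -/
def eigenEquation (a : Fin m → ℝ) (T : Matrix (Fin m) (Fin m) ℝ) (z : (Fin m → ℝ) × ℝ) :
    (Fin m → ℝ) × ℝ :=
  (T *ᵥ z.1 - z.2 • z.1, a ⬝ᵥ z.1)

theorem hasFDerivAt_eigenEquation (a : Fin m → ℝ) (z : (Fin m → ℝ) × ℝ) :
    ∃ L : (Fin m → ℝ) × ℝ →L[ℝ] (Fin m → ℝ) × ℝ, HasFDerivAt (eigenEquation a T) L z ∧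
      ∀ w, L w = (T *ᵥ w.1 - (z.2 • w.1 + w.2 • z.1), a ⬝ᵥ w.1) := by
  let L₁ : (Fin m → ℝ) →L[ℝ] (Fin m → ℝ) := LinearMap.toContinuousLinearMap T.mulVecLin
  let L₂ : (Fin m → ℝ) →L[ℝ] ℝ := LinearMap.toContinuousLinearMap (dotProductBilin ℝ ℝ a)
  have h1 : HasFDerivAt (fun w : (Fin m → ℝ) × ℝ => L₁ w.1) _ z :=
    L₁.hasFDerivAt.comp z hasFDerivAt_fst
  have h2 : HasFDerivAt (fun w : (Fin m → ℝ) × ℝ => w.2 • w.1) _ z :=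
    (hasFDerivAt_snd (𝕜 := ℝ) (p := z)).fun_smul hasFDerivAt_fst
  have h3 : HasFDerivAt (fun w : (Fin m → ℝ) × ℝ => L₂ w.1) _ z :=
    L₂.hasFDerivAt.comp z hasFDerivAt_fst
  refine ⟨_, (h1.sub h2).prodMk h3, fun w => ?_⟩
  simp [L₁, L₂]

/-- Triviality of the kernel of the Jacobian of `eigenEquation`. Pairing with the left eigenvector
kills `T - c` and leaves `w.2 = 0`; then `w.1` is a multiple of `u`, and the normalization makes it
zero. -/
theorem eigenEquation_ker [NeZero m] (hT : T.IsPrimitive) {a u : Fin m → ℝ} {c : ℝ}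
    (hu : ∀ p, 0 < u p) (hTu : T *ᵥ u = c • u) (hau : a ⬝ᵥ u = 1) {w : (Fin m → ℝ) × ℝ}
    (h1 : T *ᵥ w.1 - (c • w.1 + w.2 • u) = 0) (h2 : a ⬝ᵥ w.1 = 0) : w = 0 := by
  obtain ⟨-, u', v, h⟩ := exists_isPerronPair hT
  have hc : perronRoot T = c := perronRoot_eq_of_eigenvector hT hu hTu
  have hvu : 0 < v ⬝ᵥ u := dotProduct_pos h.left_pos (fun p => (hu p).le)
    (fun h => (hu 0).ne' (congrFun h 0))
  have h3 : v ⬝ᵥ (T *ᵥ w.1) = c * (v ⬝ᵥ w.1) := by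
    rw [Matrix.dotProduct_mulVec, h.left_eigen, hc, smul_dotProduct, smul_eq_mul]
  have h4 := congrArg (fun x => v ⬝ᵥ x) h1
  simp only [dotProduct_sub, dotProduct_add, dotProduct_smul, h3, smul_eq_mul,
    dotProduct_zero] at h4
  have h5 : w.2 * (v ⬝ᵥ u) = 0 := by linarith
  have h6 : w.2 = 0 := (mul_eq_zero.1 h5).resolve_right hvu.ne'
  rw [h6, zero_smul, add_zero, sub_eq_zero] at h1
  obtain ⟨b, hb⟩ := exists_eq_smul_of_eigenvector hT hu hTu h1
  rw [hb, dotProduct_smul, hau, smul_eq_mul, mul_one] at h2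
  rw [h2, zero_smul] at hb
  exact Prod.ext hb h6

/-- The Perron-Frobenius eigenvalue and the normalized right eigenvector of an analytic family of
primitive matrices are analytic. -/
theorem contDiff_perron [NeZero m] {E : Type*} [NormedAddCommGroup E] [NormedSpace ℝ E]
    [CompleteSpace E] {S : E → Matrix (Fin m) (Fin m) ℝ}
    (hS : ∀ p q, ContDiff ℝ ω fun t => S t p q) (hprim : ∀ t, (S t).IsPrimitive)
    {a : Fin m → ℝ} {U : E → Fin m → ℝ} (hU : ∀ t p, 0 < U t p)
    (hSU : ∀ t, S t *ᵥ U t = perronRoot (S t) • U t) (haU : ∀ t, a ⬝ᵥ U t = 1) :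
    ContDiff ℝ ω (fun t => perronRoot (S t)) ∧ ContDiff ℝ ω U := by
  suffices h : ContDiff ℝ ω fun t => (U t, perronRoot (S t)) from ⟨h.snd, h.fst⟩
  rw [contDiff_iff_contDiffAt]
  intro t₀
  let F : E × ((Fin m → ℝ) × ℝ) → (Fin m → ℝ) × ℝ := fun z => eigenEquation a (S z.1) z.2
  set z₀ := (U t₀, perronRoot (S t₀)) with hz₀
  have hF : ContDiff ℝ ω F := by
    refine ContDiff.prodMk (contDiff_pi.2 fun p => ?_) ?_
    · simp only [Pi.sub_apply, Pi.smul_apply, smul_eq_mul, Matrix.mulVec, dotProduct]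
      refine ContDiff.sub (ContDiff.sum fun q _ => ?_) (by fun_prop)
      exact ((hS p q).comp contDiff_fst).mul (by fun_prop)
    · simp only [dotProduct]
      fun_prop
  have hFat : ContDiffAt ℝ ω F (t₀, z₀) := hF.contDiffAt
  obtain ⟨L, hL, hLapp⟩ := hasFDerivAt_eigenEquation (T := S t₀) a z₀
  have hfd : fderiv ℝ F (t₀, z₀) ∘L .inr ℝ E ((Fin m → ℝ) × ℝ) = L := by
    have h1 : HasFDerivAt (fun z => F (t₀, z))
        (fderiv ℝ F (t₀, z₀) ∘L .inr ℝ E ((Fin m → ℝ) × ℝ)) z₀ :=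
      HasFDerivAt.comp (g := F) z₀ ((hF.differentiable (by simp)) (t₀, z₀)).hasFDerivAt
        (hasFDerivAt_prodMk_right t₀ z₀)
    exact h1.unique hL
  have hinj : Function.Injective L := by
    rw [injective_iff_map_eq_zero]
    intro w hw
    rw [hLapp, Prod.mk_eq_zero] at hw
    exact eigenEquation_ker (hprim t₀) (hU t₀) (hSU t₀) (haU t₀) hw.1 hw.2
  have hinv : (fderiv ℝ F (t₀, z₀) ∘L .inr ℝ E ((Fin m → ℝ) × ℝ)).IsInvertible := by
    rw [hfd]
    refine ⟨(LinearEquiv.ofInjectiveEndo (L : (Fin m → ℝ) × ℝ →ₗ[ℝ] (Fin m → ℝ) × ℝ)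
      hinj).toContinuousLinearEquiv, ?_⟩
    ext w <;> rfl
  set ψ := hFat.implicitFunction (by simp) hinv with hψ
  have hψ0 : ψ t₀ = z₀ := hFat.implicitFunction_apply_self (by simp) hinv
  have hψc : ContDiffAt ℝ ω ψ t₀ := hFat.contDiffAt_implicitFunction (by simp) hinv
  have hψF : ∀ᶠ t in 𝓝 t₀, F (t, ψ t) = F (t₀, z₀) :=
    hFat.eventually_apply_implicitFunction (by simp) hinv
  -- The family `U` is not known to be continuous, so it is identified with the implicit solution by
  -- uniqueness: the latter stays positive near `t₀`, and a positive normalized eigenvector is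
  -- unique.
  have hψpos : ∀ᶠ t in 𝓝 t₀, ∀ p, 0 < (ψ t).1 p := by
    rw [eventually_all]
    intro p
    have hc : ContinuousAt (fun t => (ψ t).1 p) t₀ :=
      (continuous_apply p).continuousAt.comp hψc.continuousAt.fst
    refine hc.eventually_const_lt ?_
    change 0 < (ψ t₀).1 p
    rw [hψ0]
    exact hU t₀ p
  refine hψc.congr_of_eventuallyEq ?_
  filter_upwards [hψF, hψpos] with t h1 h2
  have h3 : F (t₀, z₀) = (0, 1) := by
    simp only [F, eigenEquation, hz₀, hSU, haU, sub_self]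
  rw [h3] at h1
  obtain ⟨h4, h5⟩ := Prod.mk_inj.1 h1
  simp only [sub_eq_zero] at h4 h5
  have h6 := eigenvector_unique (hprim t) (hU t) (hSU t) h2 h4 (haU t) h5
  have h7 := perronRoot_eq_of_eigenvector (hprim t) h2 h4
  rw [← h6, h7]

end Perron

/-! ### Partial derivatives of analytic functions and of matrix-valued functions. -/

section Calculus

variable {ℓ m : ℕ} {f g : (Fin ℓ → ℝ) → ℝ} (i j : Fin ℓ)

theorem partialDeriv_eq_of_hasFDerivAt {t : Fin ℓ → ℝ} {f' : (Fin ℓ → ℝ) →L[ℝ] ℝ}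
    (hf : HasFDerivAt f f' t) : partialDeriv i f t = f' (Pi.single i 1) :=
  (hf.hasLineDerivAt _).lineDeriv

theorem hasFDerivAt_of_contDiff (hf : ContDiff ℝ ω f) (t : Fin ℓ → ℝ) :
    HasFDerivAt f (fderiv ℝ f t) t :=
  (hf.differentiable (by simp) t).hasFDerivAt

theorem partialDeriv_eq_fderiv (hf : ContDiff ℝ ω f) :
    partialDeriv i f = fun t => fderiv ℝ f t (Pi.single i 1) :=
  funext fun t => partialDeriv_eq_of_hasFDerivAt i (hasFDerivAt_of_contDiff hf t)

theorem contDiff_partialDeriv (hf : ContDiff ℝ ω f) : ContDiff ℝ ω (partialDeriv i f) := by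
  rw [partialDeriv_eq_fderiv i hf]
  exact (hf.fderiv_right (by simp)).clm_apply contDiff_const

theorem partialDeriv_add (hf : ContDiff ℝ ω f) (hg : ContDiff ℝ ω g) :
    partialDeriv i (fun t => f t + g t) = fun t => partialDeriv i f t + partialDeriv i g t := by
  rw [partialDeriv_eq_fderiv i hf, partialDeriv_eq_fderiv i hg]
  exact funext fun t => partialDeriv_eq_of_hasFDerivAt i
    ((hasFDerivAt_of_contDiff hf t).add (hasFDerivAt_of_contDiff hg t))

theorem partialDeriv_const (c : ℝ) : partialDeriv i (fun _ => c) = fun _ => 0 :=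
  funext fun t => partialDeriv_eq_of_hasFDerivAt i (hasFDerivAt_const c t)

theorem partialDeriv_mul (hf : ContDiff ℝ ω f) (hg : ContDiff ℝ ω g) :
    partialDeriv i (fun t => f t * g t) =
      fun t => partialDeriv i f t * g t + f t * partialDeriv i g t := by
  rw [partialDeriv_eq_fderiv i hf, partialDeriv_eq_fderiv i hg]
  refine funext fun t => (partialDeriv_eq_of_hasFDerivAt i
    ((hasFDerivAt_of_contDiff hf t).mul (hasFDerivAt_of_contDiff hg t))).trans ?_
  simp only [add_apply, smul_apply, smul_eq_mul]
  ring

theorem partialDeriv_const_mul (c : ℝ) (hf : ContDiff ℝ ω f) :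
    partialDeriv i (fun t => c * f t) = fun t => c * partialDeriv i f t := by
  rw [partialDeriv_mul i contDiff_const hf, partialDeriv_const]
  simp

theorem partialDeriv_mul_const (c : ℝ) (hf : ContDiff ℝ ω f) :
    partialDeriv i (fun t => f t * c) = fun t => partialDeriv i f t * c := by
  rw [partialDeriv_mul i hf contDiff_const, partialDeriv_const]
  simp

theorem partialDeriv_sum {ι : Type*} (s : Finset ι) {F : ι → (Fin ℓ → ℝ) → ℝ}
    (hF : ∀ a, ContDiff ℝ ω (F a)) :
    partialDeriv i (fun t => ∑ a ∈ s, F a t) = fun t => ∑ a ∈ s, partialDeriv i (F a) t := by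
  classical
  induction s using Finset.induction_on with
  | empty => simpa using partialDeriv_const i 0
  | insert a s ha ih =>
    simp only [Finset.sum_insert ha]
    rw [partialDeriv_add i (hF a) (ContDiff.sum fun b _ => hF b), ih]

theorem partialDeriv_pow (hf : ContDiff ℝ ω f) (n : ℕ) :
    partialDeriv i (fun t => f t ^ n) = fun t => n * f t ^ (n - 1) * partialDeriv i f t := by
  rw [partialDeriv_eq_fderiv i hf]
  refine funext fun t => (partialDeriv_eq_of_hasFDerivAt i
    ((hasFDerivAt_of_contDiff hf t).pow n)).trans ?_
  simp

theorem partialDeriv_exp (hf : ContDiff ℝ ω f) :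
    partialDeriv i (fun t => Real.exp (f t)) = fun t => Real.exp (f t) * partialDeriv i f t := by
  rw [partialDeriv_eq_fderiv i hf]
  exact funext fun t => partialDeriv_eq_of_hasFDerivAt i (hasFDerivAt_of_contDiff hf t).exp

theorem partialDeriv_log (hf : ContDiff ℝ ω f) (h0 : ∀ t, f t ≠ 0) :
    partialDeriv i (fun t => Real.log (f t)) = fun t => (f t)⁻¹ * partialDeriv i f t := by
  rw [partialDeriv_eq_fderiv i hf]
  exact funext fun t => partialDeriv_eq_of_hasFDerivAt i
    ((hasFDerivAt_of_contDiff hf t).log (h0 t))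

theorem partialDeriv_inv (hf : ContDiff ℝ ω f) (h0 : ∀ t, f t ≠ 0) :
    partialDeriv i (fun t => (f t)⁻¹) = fun t => -(f t ^ 2)⁻¹ * partialDeriv i f t := by
  rw [partialDeriv_eq_fderiv i hf]
  exact funext fun t => partialDeriv_eq_of_hasFDerivAt i
    ((hasDerivAt_inv (h0 t)).comp_hasFDerivAt t (hasFDerivAt_of_contDiff hf t))

theorem partialDeriv_linear (c : Fin ℓ → ℝ) :
    partialDeriv i (fun t => ∑ k, t k * c k) = fun _ => c i := by
  rw [partialDeriv_sum i _ fun k => (contDiff_apply ℝ ℝ k).mul contDiff_const]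
  funext t
  have h : ∀ k, partialDeriv i (fun t : Fin ℓ → ℝ => t k * c k) t = if k = i then c k else 0 := by
    intro k
    rw [partialDeriv_mul_const i (c k) (contDiff_apply ℝ ℝ k)]
    beta_reduce
    rw [partialDeriv_eq_of_hasFDerivAt i (hasFDerivAt_apply k t)]
    simp [Pi.single_apply]
  simp [h]

theorem hessian_log (hf : ContDiff ℝ ω f) (h0 : ∀ t, f t ≠ 0) (t : Fin ℓ → ℝ) :
    hessian (fun t => Real.log (f t)) t i j =
      partialDeriv i (partialDeriv j f) t / f t -
        partialDeriv i f t * partialDeriv j f t / f t ^ 2 := by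
  simp only [hessian, Matrix.of_apply]
  have hinv : ContDiff ℝ ω fun t => (f t)⁻¹ := hf.inv h0
  rw [partialDeriv_log j hf h0, partialDeriv_mul i hinv (contDiff_partialDeriv j hf),
    partialDeriv_inv i hf h0]
  have := h0 t
  field_simp
  ring

/-- Entrywise analyticity of a matrix-valued function. -/
def MatrixContDiff (S : (Fin ℓ → ℝ) → Matrix (Fin m) (Fin m) ℝ) : Prop :=
  ∀ p q, ContDiff ℝ ω fun t => S t p q

/-- The entrywise partial derivative of a matrix-valued function. -/
def matrixDeriv (i : Fin ℓ) (S : (Fin ℓ → ℝ) → Matrix (Fin m) (Fin m) ℝ) (t : Fin ℓ → ℝ) :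
    Matrix (Fin m) (Fin m) ℝ :=
  Matrix.of fun p q => partialDeriv i (fun s => S s p q) t

variable {S S' : (Fin ℓ → ℝ) → Matrix (Fin m) (Fin m) ℝ}

theorem MatrixContDiff.matrixDeriv (hS : MatrixContDiff S) :
    MatrixContDiff (matrixDeriv i S) := fun p q => contDiff_partialDeriv i (hS p q)

theorem MatrixContDiff.mul (hS : MatrixContDiff S) (hS' : MatrixContDiff S') :
    MatrixContDiff fun t => S t * S' t := fun p q => by
  simp only [Matrix.mul_apply]
  exact ContDiff.sum fun k _ => (hS p k).mul (hS' k q)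

theorem MatrixContDiff.pow (hS : MatrixContDiff S) (n : ℕ) :
    MatrixContDiff fun t => S t ^ n := by
  induction n with
  | zero => exact fun p q => by simpa using contDiff_const
  | succ n ih => simpa only [pow_succ] using ih.mul hS

theorem matrixDeriv_mul (hS : MatrixContDiff S) (hS' : MatrixContDiff S') :
    matrixDeriv i (fun t => S t * S' t) =
      fun t => matrixDeriv i S t * S' t + S t * matrixDeriv i S' t := by
  funext t
  ext p q
  simp only [matrixDeriv, Matrix.of_apply, Matrix.mul_apply, Matrix.add_apply]
  rw [partialDeriv_sum i _ fun k => (hS p k).mul (hS' k q), ← Finset.sum_add_distrib]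
  exact Finset.sum_congr rfl fun k _ => by rw [partialDeriv_mul i (hS p k) (hS' k q)]

theorem matrixDeriv_sum {ι : Type*} (s : Finset ι)
    {F : ι → (Fin ℓ → ℝ) → Matrix (Fin m) (Fin m) ℝ} (hF : ∀ a, MatrixContDiff (F a)) :
    matrixDeriv i (fun t => ∑ a ∈ s, F a t) = fun t => ∑ a ∈ s, matrixDeriv i (F a) t := by
  funext t
  ext p q
  simp only [matrixDeriv, Matrix.of_apply, Matrix.sum_apply]
  rw [partialDeriv_sum i _ fun k => hF k p q]

/-- Leibniz rule without commutativity. The convolution shape is the one estimated in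
`ExpSmall.convolution`. -/
theorem matrixDeriv_pow (hS : MatrixContDiff S) (n : ℕ) :
    matrixDeriv i (fun t => S t ^ n) =
      fun t => ∑ k ∈ Finset.range n, S t ^ k * matrixDeriv i S t * S t ^ (n - 1 - k) := by
  induction n with
  | zero =>
    funext t
    ext p q
    simpa [matrixDeriv] using congrFun (partialDeriv_const i ((1 : Matrix (Fin m) (Fin m) ℝ) p q)) t
  | succ n ih =>
    simp only [pow_succ]
    rw [matrixDeriv_mul i (hS.pow n) hS, ih]
    funext t
    rw [Finset.sum_range_succ, Finset.sum_mul]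
    simp only [add_tsub_cancel_right, Nat.sub_self, pow_zero, mul_one]
    congr 1
    refine Finset.sum_congr rfl fun k hk => ?_
    have : n - k = n - 1 - k + 1 := by have := Finset.mem_range.1 hk; omega
    rw [this, pow_succ, mul_assoc _ _ (S t)]

end Calculus

/-! ### Exponential decay of the powers complementary to the Perron-Frobenius projection. -/

section Decay

theorem exists_geometric_bound_of_norm_pow_le {𝔸 : Type*} [NormedRing 𝔸] {a : 𝔸} {K : ℕ}
    (hK : 0 < K) (ha : ‖a ^ K‖ ≤ 1 / 2) :
    ∃ C ρ : ℝ, 0 ≤ C ∧ 0 < ρ ∧ ρ < 1 ∧ ∀ n, ‖a ^ n‖ ≤ C * ρ ^ n := by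
  set ρ : ℝ := (1 / 2 : ℝ) ^ ((K : ℝ)⁻¹) with hρ
  have hρ0 : 0 < ρ := by positivity
  have hρK : ρ ^ K = 1 / 2 := Real.rpow_inv_natCast_pow (by norm_num) hK.ne'
  have hρ1 : ρ < 1 := by
    by_contra hcon
    have := one_le_pow₀ (not_lt.1 hcon) (n := K)
    rw [hρK] at this
    norm_num at this
  set B : ℝ := ∑ r ∈ Finset.range K, ‖a ^ r‖ with hB
  have hB0 : 0 ≤ B := Finset.sum_nonneg fun _ _ => norm_nonneg _
  -- Write `n = K (n / K) + n % K`. The factor `‖1‖ + 1` covers the exponent `n / K = 0`, as `‖1‖ =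
  -- 1` is not assumed; `B` bounds the remainder power, and `2` compensates `ρ ^ (n % K) ≥ 1 / 2`.
  refine ⟨(‖(1 : 𝔸)‖ + 1) * (B * 2), ρ, by positivity, hρ0, hρ1, fun n => ?_⟩
  have hpow : ∀ j : ℕ, ‖(a ^ K) ^ j‖ ≤ (‖(1 : 𝔸)‖ + 1) * (1 / 2) ^ j := by
    intro j
    rcases Nat.eq_zero_or_pos j with rfl | hj
    · simp
    · refine (norm_pow_le' _ hj).trans ((pow_le_pow_left₀ (norm_nonneg _) ha j).trans ?_)
      exact le_mul_of_one_le_left (by positivity) (by linarith [norm_nonneg (1 : 𝔸)])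
  have hr : n % K < K := Nat.mod_lt n hK
  have hrB : ‖a ^ (n % K)‖ ≤ B :=
    Finset.single_le_sum (f := fun r => ‖a ^ r‖) (fun _ _ => norm_nonneg _) (Finset.mem_range.2 hr)
  have hρr : (1 : ℝ) ≤ 2 * ρ ^ (n % K) := by
    have h1 : ρ ^ K ≤ ρ ^ (n % K) := pow_le_pow_of_le_one hρ0.le hρ1.le hr.le
    rw [hρK] at h1
    linarith
  calc ‖a ^ n‖ = ‖(a ^ K) ^ (n / K) * a ^ (n % K)‖ := by
        rw [← pow_mul, ← pow_add, Nat.div_add_mod]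
    _ ≤ ‖(a ^ K) ^ (n / K)‖ * ‖a ^ (n % K)‖ := norm_mul_le _ _
    _ ≤ ((‖(1 : 𝔸)‖ + 1) * (1 / 2) ^ (n / K)) * B :=
        mul_le_mul (hpow _) hrB (norm_nonneg _) (by positivity)
    _ ≤ ((‖(1 : 𝔸)‖ + 1) * (1 / 2) ^ (n / K)) * B * (2 * ρ ^ (n % K)) :=
        le_mul_of_one_le_right (by positivity) hρr
    _ = (‖(1 : 𝔸)‖ + 1) * (B * 2) * (ρ ^ (K * (n / K)) * ρ ^ (n % K)) := by
        rw [pow_mul, hρK]; ring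
    _ = (‖(1 : 𝔸)‖ + 1) * (B * 2) * ρ ^ n := by rw [← pow_add, Nat.div_add_mod]

attribute [local instance] Matrix.linftyOpNormedRing

variable {m : ℕ} {T : Matrix (Fin m) (Fin m) ℝ}

theorem abs_apply_le_norm (S : Matrix (Fin m) (Fin m) ℝ) (p q : Fin m) : |S p q| ≤ ‖S‖ := by
  rw [Matrix.linfty_opNorm_def, ← Real.norm_eq_abs, ← coe_nnnorm, NNReal.coe_le_coe]
  exact (Finset.single_le_sum (f := fun j => ‖S p j‖₊) (fun _ _ => zero_le)
    (Finset.mem_univ q)).trans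
    (Finset.le_sup (f := fun i => ∑ j, ‖S i j‖₊) (Finset.mem_univ p))

theorem norm_le_sum_abs (S : Matrix (Fin m) (Fin m) ℝ) : ‖S‖ ≤ ∑ p, ∑ q, |S p q| := by
  have h : (Finset.univ.sup fun i => ∑ j, ‖S i j‖₊) ≤ ∑ p, ∑ q, ‖S p q‖₊ :=
    Finset.sup_le fun i _ => Finset.single_le_sum (f := fun i => ∑ j, ‖S i j‖₊)
      (fun _ _ => zero_le) (Finset.mem_univ i)
  rw [Matrix.linfty_opNorm_def]
  refine (NNReal.coe_le_coe.2 h).trans (le_of_eq ?_)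
  simp

theorem tendsto_norm_zero_of_apply {S : ℕ → Matrix (Fin m) (Fin m) ℝ}
    (h : ∀ p q, Tendsto (fun n => S n p q) atTop (𝓝 0)) :
    Tendsto (fun n => ‖S n‖) atTop (𝓝 0) := by
  refine squeeze_zero (fun n => norm_nonneg _) (fun n => norm_le_sum_abs _) ?_
  rw [show (0 : ℝ) = ∑ _p : Fin m, ∑ _q : Fin m, 0 by simp]
  exact tendsto_finsetSum _ fun p _ => tendsto_finsetSum _ fun q _ => by
    simpa using (h p q).abs

section Projection

variable {u v : Fin m → ℝ}

theorem mul_vecMulVec_of_eigen (hu : T *ᵥ u = u) :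
    T * Matrix.vecMulVec u v = Matrix.vecMulVec u v := by
  rw [Matrix.mul_vecMulVec, hu]

theorem vecMulVec_mul_of_eigen (hv : v ᵥ* T = v) :
    Matrix.vecMulVec u v * T = Matrix.vecMulVec u v := by
  rw [Matrix.vecMulVec_mul, hv]

theorem vecMulVec_mul_self (h : v ⬝ᵥ u = 1) :
    Matrix.vecMulVec u v * Matrix.vecMulVec u v = Matrix.vecMulVec u v := by
  rw [Matrix.vecMulVec_mul_vecMulVec, h, one_smul]

/-- Powers of `a - c • p`, where `p` is an idempotent with `a p = p a = c p`. -/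
theorem sub_smul_idempotent_pow {R : Type*} [Ring R] [Algebra ℝ R] {a p : R} {c : ℝ}
    (h1 : a * p = c • p) (h2 : p * a = c • p) (h3 : p * p = p) {n : ℕ} (hn : 0 < n) :
    (a - c • p) ^ n = a ^ n - c ^ n • p := by
  induction n, hn using Nat.le_induction with
  | base => simp
  | succ n hn ih =>
    have h4 : a ^ n * p = c ^ n • p := by
      clear ih hn
      induction n with
      | zero => simp
      | succ n ih => rw [pow_succ, mul_assoc, h1, mul_smul_comm, ih, smul_smul, pow_succ, mul_comm]
    rw [pow_succ, ih, sub_mul, mul_sub, mul_sub, ← pow_succ, mul_smul_comm, h4, smul_mul_assoc, h2,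
      smul_mul_assoc, mul_smul_comm, h3]
    simp only [smul_smul]
    rw [mul_comm (c ^ n) c, ← pow_succ']
    abel

end Projection

/-- Doeblin minorization, with no information on the other eigenvalues: the positive matrix `T ^ k`
dominates `δ P` with `P = u v'`. The rest `N = T ^ k - δ P` is nonnegative with `N u = (1 - δ) u`,
so `N ^ j → 0`, and some power of `T - P` has norm at most `1 / 2`. -/
theorem exists_geometric_bound [NeZero m] (hT : T.IsPrimitive) {u v : Fin m → ℝ}
    (hu : ∀ p, 0 < u p) (hv : ∀ p, 0 < v p) (hTu : T *ᵥ u = u) (hTv : v ᵥ* T = v)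
    (hvu : v ⬝ᵥ u = 1) :
    ∃ C ρ : ℝ, 0 ≤ C ∧ 0 < ρ ∧ ρ < 1 ∧ ∀ n, ‖(T - Matrix.vecMulVec u v) ^ n‖ ≤ C * ρ ^ n := by
  obtain ⟨hT0, k, hk0, hk⟩ := hT
  set P := Matrix.vecMulVec u v with hP
  have hPP : P * P = P := vecMulVec_mul_self hvu
  have hTP : T * P = P := mul_vecMulVec_of_eigen hTu
  have hPT : P * T = P := vecMulVec_mul_of_eigen hTv
  have hkP : T ^ k * P = P := by
    rw [hP, Matrix.mul_vecMulVec, pow_mulVec_eigenvector (c := 1) (by simpa using hTu)]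
    simp
  have hPk : P * T ^ k = P := by
    clear hk hk0 hkP
    induction k with
    | zero => simp
    | succ k ih => rw [pow_succ, ← mul_assoc, ih, hPT]
  have hsub : ∀ n, 0 < n → (T - P) ^ n = T ^ n - P := fun n hn => by
    have := sub_smul_idempotent_pow (a := T) (p := P) (c := (1 : ℝ)) (by simpa using hTP)
      (by simpa using hPT) hPP hn
    simpa using this
  obtain ⟨δ, hδ0, hδ1, hδ⟩ : ∃ δ : ℝ, 0 < δ ∧ δ < 1 ∧ ∀ p q, δ * P p q ≤ (T ^ k) p q := by
    obtain ⟨z, hz⟩ := Finite.exists_min fun z : Fin m × Fin m => (T ^ k) z.1 z.2 / P z.1 z.2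
    have hPpos : ∀ p q, 0 < P p q := fun p q => mul_pos (hu p) (hv q)
    -- The minimum with `1 / 2` keeps `δ < 1`.
    refine ⟨min ((T ^ k) z.1 z.2 / P z.1 z.2) (1 / 2), lt_min (div_pos (hk _ _) (hPpos _ _))
      (by norm_num), (min_le_right _ _).trans_lt (by norm_num), fun p q => ?_⟩
    exact (le_div_iff₀ (hPpos p q)).1 ((min_le_left _ _).trans (hz (p, q)))
  set N := T ^ k - δ • P with hN
  have hN0 : ∀ p q, 0 ≤ N p q := fun p q => by
    simpa [hN] using hδ p q
  have hNu : N *ᵥ u = (1 - δ) • u := by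
    have hPu : P *ᵥ u = u := by
      rw [hP, Matrix.vecMulVec_mulVec, hvu]
      simp
    rw [hN, Matrix.sub_mulVec, Matrix.smul_mulVec, hPu,
      pow_mulVec_eigenvector (c := 1) (by simpa using hTu), sub_smul, one_pow]
  have hNP : N * P = (1 - δ) • P := by
    rw [hN, sub_mul, hkP, smul_mul_assoc, hPP, sub_smul, one_smul]
  have hPN : P * N = (1 - δ) • P := by
    rw [hN, mul_sub, hPk, mul_smul_comm, hPP, sub_smul, one_smul]
  -- Both sides are the `j`-th power of `T ^ k - P = N - (1 - δ) P`.
  have hkey : ∀ j, 0 < j → (T - P) ^ (k * j) = N ^ j - (1 - δ) ^ j • P := fun j hj => by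
    rw [← sub_smul_idempotent_pow hNP hPN hPP hj, pow_mul, hsub k hk0, hN, sub_smul, one_smul]
    congr 1
    abel
  have hNj : ∀ p q, Tendsto (fun j => (N ^ j) p q) atTop (𝓝 0) := fun p q => by
    have h0 : ∀ j, 0 ≤ (N ^ j) p q := fun j => Matrix.pow_apply_nonneg hN0 j p q
    have h1 : ∀ j, (N ^ j) p q ≤ (1 - δ) ^ j * (u p / u q) := fun j => by
      have h2 := congrFun (pow_mulVec_eigenvector hNu j) p
      have h3 : (N ^ j) p q * u q ≤ (N ^ j *ᵥ u) p := by
        unfold Matrix.mulVec dotProduct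
        exact Finset.single_le_sum (f := fun r => (N ^ j) p r * u r)
          (fun r _ => mul_nonneg (Matrix.pow_apply_nonneg hN0 j p r) (hu r).le) (Finset.mem_univ q)
      rw [h2] at h3
      rw [← mul_div_assoc]
      exact (le_div_iff₀ (hu q)).2 h3
    refine squeeze_zero h0 h1 ?_
    simpa using (tendsto_pow_atTop_nhds_zero_of_lt_one (by linarith : (0 : ℝ) ≤ 1 - δ)
      (by linarith)).mul_const (u p / u q)
  have hlim : Tendsto (fun j => ‖N ^ j - (1 - δ) ^ j • P‖) atTop (𝓝 0) := by
    refine tendsto_norm_zero_of_apply fun p q => ?_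
    simpa using (hNj p q).sub ((tendsto_pow_atTop_nhds_zero_of_lt_one
      (by linarith : (0 : ℝ) ≤ 1 - δ) (by linarith)).mul_const (P p q))
  obtain ⟨j, hj, hj0⟩ := ((hlim.eventually (ge_mem_nhds (by norm_num : (0 : ℝ) < 1 / 2))).and
    (eventually_gt_atTop 0)).exists
  refine exists_geometric_bound_of_norm_pow_le (Nat.mul_pos hk0 hj0) ?_
  rw [hkey j hj0]
  exact hj

end Decay

/-! ### Calculus of exponentially small sequences. -/

section ExpSmall

variable {E : Type*} [NormedAddCommGroup E] {a b : ℕ → E}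

/-- A sequence is exponentially small if it is `O(ε ^ n)` for some `0 < ε < 1`. -/
def ExpSmall (a : ℕ → E) : Prop :=
  ∃ ε : ℝ, 0 < ε ∧ ε < 1 ∧ a =O[atTop] fun n : ℕ => ε ^ n

theorem isBigO_pow_of_le {ε ε' : ℝ} (h0 : 0 < ε) (h : ε ≤ ε')
    (ha : a =O[atTop] fun n : ℕ => ε ^ n) : a =O[atTop] fun n : ℕ => ε' ^ n := by
  refine ha.trans (IsBigO.of_bound 1 (Eventually.of_forall fun n => ?_))
  rw [one_mul, norm_pow, norm_pow, Real.norm_of_nonneg h0.le, Real.norm_of_nonneg (h0.le.trans h)]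
  exact pow_le_pow_left₀ h0.le h n

theorem ExpSmall.bound (ha : ExpSmall a) :
    ∃ C ρ : ℝ, 0 < C ∧ 0 < ρ ∧ ρ < 1 ∧ ∀ n, ‖a n‖ ≤ C * ρ ^ n := by
  obtain ⟨ε, h0, h1, h⟩ := ha
  obtain ⟨C, hC, hbd⟩ := bound_of_isBigO_nat_atTop h
  refine ⟨C, ε, hC, h0, h1, fun n => ?_⟩
  have := hbd (x := n) (pow_pos h0 n).ne'
  rwa [norm_pow, Real.norm_of_nonneg h0.le] at this

theorem ExpSmall.of_bound {C ρ : ℝ} (h0 : 0 < ρ) (h1 : ρ < 1) (h : ∀ n, ‖a n‖ ≤ C * ρ ^ n) :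
    ExpSmall a := by
  refine ⟨ρ, h0, h1, IsBigO.of_bound C (Eventually.of_forall fun n => ?_)⟩
  rw [norm_pow, Real.norm_of_nonneg h0.le]
  exact h n

theorem ExpSmall.congr (ha : ExpSmall a) (h : a =ᶠ[atTop] b) : ExpSmall b := by
  obtain ⟨ε, h0, h1, h2⟩ := ha
  exact ⟨ε, h0, h1, h2.congr' h EventuallyEq.rfl⟩

theorem ExpSmall.add (ha : ExpSmall a) (hb : ExpSmall b) : ExpSmall fun n => a n + b n := by
  obtain ⟨ε, h0, h1, h2⟩ := ha
  obtain ⟨ε', h0', h1', h2'⟩ := hb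
  exact ⟨max ε ε', lt_max_of_lt_left h0, max_lt h1 h1',
    (isBigO_pow_of_le h0 (le_max_left _ _) h2).add (isBigO_pow_of_le h0' (le_max_right _ _) h2')⟩

theorem ExpSmall.neg (ha : ExpSmall a) : ExpSmall fun n => -a n := by
  obtain ⟨ε, h0, h1, h2⟩ := ha
  exact ⟨ε, h0, h1, h2.neg_left⟩

theorem ExpSmall.sub (ha : ExpSmall a) (hb : ExpSmall b) : ExpSmall fun n => a n - b n := by
  simpa only [sub_eq_add_neg] using ha.add hb.neg

theorem expSmall_zero : ExpSmall fun _ => (0 : E) :=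
  ⟨1 / 2, by norm_num, by norm_num, isBigO_zero _ _⟩

theorem ExpSmall.sum {ι : Type*} (s : Finset ι) {F : ι → ℕ → E} (h : ∀ k, ExpSmall (F k)) :
    ExpSmall fun n => ∑ k ∈ s, F k n := by
  classical
  induction s using Finset.induction_on with
  | empty => simpa using expSmall_zero
  | insert k s hk ih => simpa only [Finset.sum_insert hk] using (h k).add ih

theorem isLittleO_pow_mul_pow (k : ℕ) {ρ : ℝ} (h0 : 0 < ρ) (h1 : ρ < 1) :
    (fun n : ℕ => (n : ℝ) ^ k * ρ ^ n) =o[atTop] fun n => ((ρ + 1) / 2) ^ n :=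
  isLittleO_pow_const_mul_const_pow_const_pow_of_norm_lt k
    (by rw [Real.norm_of_nonneg h0.le]; linarith)

theorem ExpSmall.mul_isBigO {a b : ℕ → ℝ} (ha : ExpSmall a) {k : ℕ}
    (hb : b =O[atTop] fun n : ℕ => (n : ℝ) ^ k) : ExpSmall fun n => b n * a n := by
  obtain ⟨ε, h0, h1, h2⟩ := ha
  exact ⟨(ε + 1) / 2, by linarith, by linarith,
    (hb.mul h2).trans (isLittleO_pow_mul_pow k h0 h1).isBigO⟩

theorem ExpSmall.const_mul {a : ℕ → ℝ} (ha : ExpSmall a) (c : ℝ) : ExpSmall fun n => c * a n :=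
  ha.mul_isBigO (k := 0) (by simpa using isBigO_const_const c (one_ne_zero (α := ℝ)) atTop)

theorem ExpSmall.tendsto (ha : ExpSmall a) : Tendsto a atTop (𝓝 0) := by
  obtain ⟨ε, h0, h1, h2⟩ := ha
  exact h2.trans_tendsto (tendsto_pow_atTop_nhds_zero_of_lt_one h0.le h1)

/-- With `σ` the larger of the two rates, each of the `n` summands is `O(σ ^ (n - 1))`; the
resulting factor `n` is absorbed by the worse rate `(σ + 1) / 2`. -/
theorem ExpSmall.convolution {𝔸 : Type*} [NormedRing 𝔸] {a b : ℕ → 𝔸} (ha : ExpSmall a)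
    (hb : ExpSmall b) (d : 𝔸) :
    ExpSmall fun n => ∑ k ∈ Finset.range n, a k * d * b (n - 1 - k) := by
  obtain ⟨C, ρ, hC, h0, h1, hbd⟩ := ha.bound
  obtain ⟨C', ρ', hC', h0', h1', hbd'⟩ := hb.bound
  set σ := max ρ ρ' with hσ
  have hσ0 : 0 < σ := lt_max_of_lt_left h0
  have hσ1 : σ < 1 := max_lt h1 h1'
  have hterm : ∀ n, ∀ k ∈ Finset.range n,
      ‖a k * d * b (n - 1 - k)‖ ≤ C * ‖d‖ * C' * σ⁻¹ * σ ^ n := by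
    intro n k hk
    have hkn := Finset.mem_range.1 hk
    have e1 : ‖a k‖ ≤ C * σ ^ k := (hbd k).trans
      (mul_le_mul_of_nonneg_left (pow_le_pow_left₀ h0.le (le_max_left _ _) k) hC.le)
    have e2 : ‖b (n - 1 - k)‖ ≤ C' * σ ^ (n - 1 - k) := (hbd' _).trans
      (mul_le_mul_of_nonneg_left (pow_le_pow_left₀ h0'.le (le_max_right _ _) _) hC'.le)
    calc ‖a k * d * b (n - 1 - k)‖ ≤ ‖a k‖ * ‖d‖ * ‖b (n - 1 - k)‖ :=
          (norm_mul_le _ _).trans (mul_le_mul_of_nonneg_right (norm_mul_le _ _) (norm_nonneg _))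
      _ ≤ C * σ ^ k * ‖d‖ * (C' * σ ^ (n - 1 - k)) := by gcongr
      _ = C * ‖d‖ * C' * σ⁻¹ * σ ^ n := by
          have : n = k + (n - 1 - k) + 1 := by omega
          conv_rhs => rw [this]
          rw [pow_succ, pow_add]
          field_simp
  refine ⟨(σ + 1) / 2, by linarith, by linarith, ?_⟩
  refine IsBigO.trans ?_ (isLittleO_pow_mul_pow 1 hσ0 hσ1).isBigO
  refine IsBigO.of_bound (C * ‖d‖ * C' * σ⁻¹) (Eventually.of_forall fun n => ?_)
  refine (norm_sum_le_of_le _ (hterm n)).trans (le_of_eq ?_)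
  rw [Finset.sum_const, Finset.card_range, nsmul_eq_mul, pow_one, norm_mul, norm_pow,
    Real.norm_of_nonneg hσ0.le, Real.norm_natCast]
  ring

end ExpSmall

/-! ### Derivatives of decaying matrix powers. -/

section PowerDecay

attribute [local instance] Matrix.linftyOpNormedRing

variable {ℓ m : ℕ} {Q : (Fin ℓ → ℝ) → Matrix (Fin m) (Fin m) ℝ}

/-- Decay at the single point `t` is enough: the derivative of `Q ^ n` at `t` is a convolution of
powers of `Q t`. -/
theorem expSmall_matrixDeriv_pow (hQ : MatrixContDiff Q) {t : Fin ℓ → ℝ}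
    (h : ExpSmall fun n => Q t ^ n) (i : Fin ℓ) :
    ExpSmall fun n => matrixDeriv i (fun s => Q s ^ n) t := by
  refine (h.convolution h (matrixDeriv i Q t)).congr (Eventually.of_forall fun n => ?_)
  simp only [matrixDeriv_pow i hQ]

theorem expSmall_matrixDeriv_matrixDeriv_pow (hQ : MatrixContDiff Q) {t : Fin ℓ → ℝ}
    (h : ExpSmall fun n => Q t ^ n) (i j : Fin ℓ) :
    ExpSmall fun n => matrixDeriv i (matrixDeriv j fun s => Q s ^ n) t := by
  have hi := expSmall_matrixDeriv_pow hQ h i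
  have hjQ := hQ.matrixDeriv j
  refine (((hi.convolution h (matrixDeriv j Q t)).add
    (h.convolution h (matrixDeriv i (matrixDeriv j Q) t))).add
    (h.convolution hi (matrixDeriv j Q t))).congr (Eventually.of_forall fun n => ?_)
  beta_reduce
  rw [matrixDeriv_pow j hQ,
    matrixDeriv_sum i _ fun k => ((hQ.pow k).mul hjQ).mul (hQ.pow (n - 1 - k)),
    ← Finset.sum_add_distrib, ← Finset.sum_add_distrib]
  refine Finset.sum_congr rfl fun k _ => ?_
  rw [matrixDeriv_mul i ((hQ.pow k).mul hjQ) (hQ.pow (n - 1 - k)), matrixDeriv_mul i (hQ.pow k) hjQ]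
  simp only [add_mul]

theorem ExpSmall.apply {X : ℕ → Matrix (Fin m) (Fin m) ℝ} (h : ExpSmall X) (p q : Fin m) :
    ExpSmall fun n => X n p q := by
  obtain ⟨C, ρ, -, h0, h1, hbd⟩ := h.bound
  exact ExpSmall.of_bound h0 h1 fun n => (abs_apply_le_norm _ p q).trans (hbd n)

theorem dotProduct_mulVec_eq_sum (ξ η : Fin m → ℝ) (X : Matrix (Fin m) (Fin m) ℝ) :
    ξ ⬝ᵥ (X *ᵥ η) = ∑ p, ∑ q, ξ p * η q * X p q := by
  simp only [dotProduct, Matrix.mulVec, Finset.mul_sum]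
  exact Finset.sum_congr rfl fun p _ => Finset.sum_congr rfl fun q _ => by ring

theorem ExpSmall.dotProduct_mulVec {X : ℕ → Matrix (Fin m) (Fin m) ℝ} (h : ExpSmall X)
    (ξ η : Fin m → ℝ) : ExpSmall fun n => ξ ⬝ᵥ (X n *ᵥ η) := by
  simp only [dotProduct_mulVec_eq_sum]
  exact ExpSmall.sum _ fun p => ExpSmall.sum _ fun q => (h.apply p q).const_mul _

theorem MatrixContDiff.dotProduct_mulVec (hQ : MatrixContDiff Q) (ξ η : Fin m → ℝ) :
    ContDiff ℝ ω fun t => ξ ⬝ᵥ (Q t *ᵥ η) := by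
  simp only [dotProduct_mulVec_eq_sum]
  exact ContDiff.sum fun p _ => ContDiff.sum fun q _ => contDiff_const.mul (hQ p q)

theorem partialDeriv_dotProduct_mulVec (hQ : MatrixContDiff Q) (ξ η : Fin m → ℝ) (i : Fin ℓ) :
    partialDeriv i (fun t => ξ ⬝ᵥ (Q t *ᵥ η)) = fun t => ξ ⬝ᵥ (matrixDeriv i Q t *ᵥ η) := by
  simp only [dotProduct_mulVec_eq_sum]
  rw [partialDeriv_sum i _ fun p => ContDiff.sum fun q _ => contDiff_const.mul (hQ p q)]
  refine funext fun t => Finset.sum_congr rfl fun p _ => ?_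
  rw [partialDeriv_sum i _ fun q => contDiff_const.mul (hQ p q)]
  exact Finset.sum_congr rfl fun q _ => by rw [partialDeriv_const_mul i _ (hQ p q)]; rfl

/-- If the powers of `Q t` decay exponentially, so do the bilinear forms `ξ' Q ^ n η` together with
their derivatives of order at most two at `t`. -/
theorem expSmall_bilinear (hQ : MatrixContDiff Q) {t : Fin ℓ → ℝ} (h : ExpSmall fun n => Q t ^ n)
    (ξ η : Fin m → ℝ) :
    (ExpSmall fun n => ξ ⬝ᵥ (Q t ^ n *ᵥ η)) ∧
    (∀ i, ExpSmall fun n => partialDeriv i (fun s => ξ ⬝ᵥ (Q s ^ n *ᵥ η)) t) ∧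
    ∀ i j, ExpSmall fun n =>
      partialDeriv i (partialDeriv j fun s => ξ ⬝ᵥ (Q s ^ n *ᵥ η)) t := by
  refine ⟨h.dotProduct_mulVec ξ η, fun i => ?_, fun i j => ?_⟩
  · refine ((expSmall_matrixDeriv_pow hQ h i).dotProduct_mulVec ξ η).congr
      (Eventually.of_forall fun n => ?_)
    beta_reduce
    rw [partialDeriv_dotProduct_mulVec (hQ.pow n)]
  · refine ((expSmall_matrixDeriv_matrixDeriv_pow hQ h i j).dotProduct_mulVec ξ η).congr
      (Eventually.of_forall fun n => ?_)
    beta_reduce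
    rw [partialDeriv_dotProduct_mulVec (hQ.pow n),
      partialDeriv_dotProduct_mulVec ((hQ.pow n).matrixDeriv j)]

end PowerDecay

/-! ### The generating function of words and the moments of the letter counts. -/

section Words

/-- Noncommutative expansion of a power, splitting off the first letter so that the order of the
factors is kept. -/
theorem sum_ofFn_prod {α R : Type*} [Fintype α] [Semiring R] (f : α → R) (n : ℕ) :
    ∑ w : Fin n → α, (List.ofFn fun k => f (w k)).prod = (∑ x, f x) ^ n := by
  induction n with
  | zero => simp
  | succ n ih =>
    rw [← (Fin.consEquiv fun _ => α).sum_comp, Fintype.sum_prod_type, pow_succ', Finset.sum_mul]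
    refine Finset.sum_congr rfl fun x _ => ?_
    rw [← ih, Finset.mul_sum]
    refine Finset.sum_congr rfl fun w _ => ?_
    simp [Fin.consEquiv, List.ofFn_succ]

theorem prod_map_smul {α R : Type*} [Ring R] [Algebra ℝ R] (c : α → ℝ) (f : α → R) (L : List α) :
    (L.map fun x => c x • f x).prod = (L.map c).prod • (L.map f).prod := by
  induction L with
  | nil => simp
  | cons x L ih => simp [ih, smul_smul, mul_comm]

variable {ℓ m : ℕ}

/-- The weight `e^{t_i}` of the letter `a_i`; the letter `b` has weight `1`. -/
def letterExp (t : Fin ℓ → ℝ) : Letter ℓ → ℝ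
  | some i => Real.exp (t i)
  | none => 1

theorem prod_map_letterExp (t : Fin ℓ → ℝ) (L : List (Letter ℓ)) :
    (L.map (letterExp t)).prod = Real.exp (∑ i, t i * (L.count (some i) : ℝ)) := by
  induction L with
  | nil => simp
  | cons x L ih =>
    rw [List.map_cons, List.prod_cons, ih]
    cases x with
    | none => simp [letterExp]
    | some j =>
      simp only [letterExp, ← Real.exp_add, List.count_cons]
      congr 1
      push_cast
      simp only [mul_add, Finset.sum_add_distrib]
      rw [add_comm]
      congr 1
      simp

namespace LinearRepresentation

variable (R : LinearRepresentation ℓ m)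

theorem sum_letterExp_smul (t : Fin ℓ → ℝ) :
    ∑ x, letterExp t x • R.letterMatrix x = R.Mt t := by
  rw [Fintype.sum_option, Mt, add_comm]
  simp [letterExp, letterMatrix]

theorem sum_exp_smul_wordMatrix (t : Fin ℓ → ℝ) (n : ℕ) :
    ∑ w : Word ℓ n, Real.exp (∑ i, t i * R.Y n i w) • R.wordMatrix w = R.Mt t ^ n := by
  rw [← R.sum_letterExp_smul t, ← sum_ofFn_prod]
  refine Finset.sum_congr rfl fun w _ => ?_
  have h1 : (List.ofFn fun k => letterExp t (w k) • R.letterMatrix (w k)) =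
      (List.ofFn (show Fin n → Letter ℓ from w)).map
        fun x => letterExp t x • R.letterMatrix x := by
    rw [List.map_ofFn]; rfl
  have h2 : R.wordMatrix w =
      ((List.ofFn (show Fin n → Letter ℓ from w)).map R.letterMatrix).prod := by
    rw [List.map_ofFn]; rfl
  rw [h1, prod_map_smul, prod_map_letterExp, h2]
  rfl

/-- The unnormalized moment generating function `ξ' M(t) ^ n η` of `Y_n`. -/
def genFun (n : ℕ) (t : Fin ℓ → ℝ) : ℝ := R.ξ ⬝ᵥ (R.Mt t ^ n *ᵥ R.η)

theorem genFun_eq_sum (n : ℕ) :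
    R.genFun n = fun t => ∑ w : Word ℓ n, R.series w * Real.exp (∑ i, t i * R.Y n i w) := by
  funext t
  rw [genFun, ← sum_exp_smul_wordMatrix, Matrix.sum_mulVec, dotProduct_sum]
  refine Finset.sum_congr rfl fun w _ => ?_
  rw [Matrix.smul_mulVec, dotProduct_smul, smul_eq_mul, mul_comm, series]

theorem contDiff_exp_linear (c : Fin ℓ → ℝ) :
    ContDiff ℝ ω fun t : Fin ℓ → ℝ => Real.exp (∑ i, t i * c i) := by
  fun_prop

theorem partialDeriv_exp_linear (c : Fin ℓ → ℝ) (i : Fin ℓ) :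
    partialDeriv i (fun t => Real.exp (∑ k, t k * c k)) =
      fun t => c i * Real.exp (∑ k, t k * c k) := by
  rw [partialDeriv_exp i (by fun_prop), partialDeriv_linear]
  exact funext fun t => mul_comm _ _

theorem partialDeriv_genFun (n : ℕ) (i : Fin ℓ) : partialDeriv i (R.genFun n) =
    fun t => ∑ w : Word ℓ n, R.series w * R.Y n i w * Real.exp (∑ i, t i * R.Y n i w) := by
  rw [genFun_eq_sum, partialDeriv_sum i _ fun w => contDiff_const.mul (contDiff_exp_linear _)]
  refine funext fun t => Finset.sum_congr rfl fun w _ => ?_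
  rw [partialDeriv_const_mul i _ (contDiff_exp_linear _), partialDeriv_exp_linear]
  ring

theorem partialDeriv_partialDeriv_genFun (n : ℕ) (i j : Fin ℓ) :
    partialDeriv i (partialDeriv j (R.genFun n)) = fun t => ∑ w : Word ℓ n,
      R.series w * (R.Y n i w * R.Y n j w) * Real.exp (∑ i, t i * R.Y n i w) := by
  rw [partialDeriv_genFun, partialDeriv_sum i _ fun w => contDiff_const.mul (contDiff_exp_linear _)]
  refine funext fun t => Finset.sum_congr rfl fun w _ => ?_
  rw [partialDeriv_const_mul i _ (contDiff_exp_linear _), partialDeriv_exp_linear]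
  ring

theorem genFun_zero (n : ℕ) : R.genFun n 0 = R.totalWeight n := by
  rw [genFun_eq_sum]
  simp [totalWeight]

instance (n : ℕ) : DiscreteMeasurableSpace (Word ℓ n) := ⟨fun _ => trivial⟩

theorem prob_nonneg {n : ℕ} (w : Word ℓ n) : 0 ≤ R.prob w :=
  div_nonneg (R.series_nonneg w) (Finset.sum_nonneg fun w _ => R.series_nonneg w)

/-- If the total weight vanishes, both sides are `0` by the convention `x / 0 = 0`. -/
theorem integral_wordMeasure (n : ℕ) (f : Word ℓ n → ℝ) :
    ∫ w, f w ∂(R.wordMeasure n) = (∑ w, R.series w * f w) / R.totalWeight n := by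
  have hint : ∀ w ∈ (Finset.univ : Finset (Word ℓ n)),
      Integrable f (ENNReal.ofReal (R.prob w) • Measure.dirac w) := fun w _ =>
    Integrable.smul_measure (Integrable.of_finite) ENNReal.ofReal_ne_top
  rw [wordMeasure, integral_finsetSum_measure hint, Finset.sum_div]
  refine Finset.sum_congr rfl fun w _ => ?_
  rw [integral_smul_measure, integral_dirac, ENNReal.toReal_ofReal (R.prob_nonneg w), prob,
    smul_eq_mul]
  ring

theorem integral_Y (n : ℕ) (i : Fin ℓ) :
    ∫ w, R.Y n i w ∂(R.wordMeasure n) = partialDeriv i (R.genFun n) 0 / R.genFun n 0 := by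
  rw [integral_wordMeasure, partialDeriv_genFun, genFun_zero]
  simp

theorem covariance_Y {n : ℕ} (h : ∃ w : Word ℓ n, 0 < R.series w) (i j : Fin ℓ) :
    cov[R.Y n i, R.Y n j; R.wordMeasure n] =
      partialDeriv i (partialDeriv j (R.genFun n)) 0 / R.genFun n 0 -
        partialDeriv i (R.genFun n) 0 / R.genFun n 0 *
          (partialDeriv j (R.genFun n) 0 / R.genFun n 0) := by
  have := R.isProbabilityMeasure_wordMeasure h
  rw [covariance_eq_sub MemLp.of_discrete MemLp.of_discrete, integral_Y, integral_Y,
    integral_wordMeasure, partialDeriv_partialDeriv_genFun, genFun_zero]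
  simp

end LinearRepresentation
end Words

/-! ### Primitivity, eigenvectors and eigenvalue derivatives of the family `M(t)`. -/

theorem pow_apply_le_pow_apply {m : ℕ} {S S' : Matrix (Fin m) (Fin m) ℝ} (h0 : ∀ p q, 0 ≤ S p q)
    (h : ∀ p q, S p q ≤ S' p q) (k : ℕ) (p q : Fin m) : (S ^ k) p q ≤ (S' ^ k) p q := by
  induction k generalizing p q with
  | zero => simp
  | succ k ih =>
    rw [pow_succ, pow_succ, Matrix.mul_apply, Matrix.mul_apply]
    exact Finset.sum_le_sum fun r _ => mul_le_mul (ih p r) (h r q) (h0 r q)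
      ((Matrix.pow_apply_nonneg h0 k p r).trans (ih p r))

theorem isPrimitive_of_smul_le {m : ℕ} {S S' : Matrix (Fin m) (Fin m) ℝ} (hS : S.IsPrimitive)
    {c : ℝ} (hc : 0 < c) (h : ∀ p q, c * S p q ≤ S' p q) : S'.IsPrimitive := by
  obtain ⟨h0, k, hk0, hk⟩ := hS
  have h0' : ∀ p q, 0 ≤ (c • S) p q := fun p q => mul_nonneg hc.le (h0 p q)
  refine ⟨fun p q => (h0' p q).trans (h p q), k, hk0, fun p q => ?_⟩
  refine lt_of_lt_of_le ?_ (pow_apply_le_pow_apply h0' h k p q)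
  rw [smul_pow]
  exact mul_pos (pow_pos hc k) (hk p q)

namespace LinearRepresentation

variable {ℓ m : ℕ} (R : LinearRepresentation ℓ m)

theorem neZero (R : LinearRepresentation ℓ m) (hℓ : 0 < ℓ) : NeZero m := by
  refine ⟨fun hm => R.A_ne_zero ⟨0, hℓ⟩ ?_⟩
  subst hm
  ext p
  exact p.elim0

theorem Mt_apply (t : Fin ℓ → ℝ) (p q : Fin m) :
    R.Mt t p q = ∑ i, Real.exp (t i) * R.A i p q + R.B p q := by
  simp [Mt, Matrix.sum_apply]

theorem Mt_zero : R.Mt 0 = R.M := by simp [Mt, M]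

theorem matrixContDiff_Mt : MatrixContDiff R.Mt := fun p q => by
  simp only [Mt_apply]
  fun_prop

theorem partialDeriv_Mt_apply (i : Fin ℓ) (p q : Fin m) :
    partialDeriv i (fun t => R.Mt t p q) = fun t => Real.exp (t i) * R.A i p q := by
  simp only [Mt_apply]
  rw [partialDeriv_add i (by fun_prop) contDiff_const, partialDeriv_const,
    partialDeriv_sum i _ fun k => by fun_prop]
  funext t
  have h : ∀ k, partialDeriv i (fun t : Fin ℓ → ℝ => Real.exp (t k) * R.A k p q) t =
      if k = i then Real.exp (t k) * R.A k p q else 0 := by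
    intro k
    rw [partialDeriv_mul_const i _ (by fun_prop), partialDeriv_exp i (contDiff_apply ℝ ℝ k)]
    beta_reduce
    rw [partialDeriv_eq_of_hasFDerivAt i (hasFDerivAt_apply k t)]
    simp [Pi.single_apply]
  simp [h]

theorem isPrimitive_Mt (hM : R.M.IsPrimitive) (t : Fin ℓ → ℝ) : (R.Mt t).IsPrimitive := by
  have hsum : 0 ≤ ∑ i, |t i| := Finset.sum_nonneg fun _ _ => abs_nonneg _
  -- The constant `e^{-∑ |t_i|}` lies below every `e^{t_i}` and below the weight `1` of `B`.
  refine isPrimitive_of_smul_le hM (Real.exp_pos (-∑ i, |t i|)) fun p q => ?_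
  rw [← Mt_zero, Mt_apply, Mt_apply, mul_add, Finset.mul_sum]
  refine add_le_add (Finset.sum_le_sum fun i _ => ?_) ?_
  · rw [Pi.zero_apply, Real.exp_zero, one_mul]
    refine mul_le_mul_of_nonneg_right (Real.exp_le_exp.2 ?_) (R.A_nonneg i p q)
    have h1 : |t i| ≤ ∑ i, |t i| :=
      Finset.single_le_sum (f := fun i => |t i|) (fun _ _ => abs_nonneg _) (Finset.mem_univ i)
    linarith [neg_abs_le (t i)]
  · exact mul_le_of_le_one_left (R.B_nonneg p q) (Real.exp_le_one_iff.2 (by linarith))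

theorem y_zero : R.y 0 = perronRoot R.M := by rw [y, Mt_zero]

theorem y_pos [NeZero m] (hM : R.M.IsPrimitive) (t : Fin ℓ → ℝ) : 0 < R.y t :=
  (exists_isPerronPair (R.isPrimitive_Mt hM t)).1

theorem exists_perronPairs [NeZero m] (hM : R.M.IsPrimitive) :
    ∃ u v : (Fin ℓ → ℝ) → Fin m → ℝ, ∀ t, IsPerronPair (R.Mt t) (u t) (v t) := by
  choose u v h using fun t => (exists_isPerronPair (R.isPrimitive_Mt hM t)).2
  exact ⟨u, v, h⟩

theorem det_eq_zero [NeZero m] (hM : R.M.IsPrimitive) (t : Fin ℓ → ℝ) :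
    (R.y t • (1 : Matrix (Fin m) (Fin m) ℝ) - R.Mt t).det = 0 := by
  obtain ⟨-, u, v, h⟩ := exists_isPerronPair (R.isPrimitive_Mt hM t)
  refine Matrix.exists_mulVec_eq_zero_iff.1 ⟨u, fun h0 => (h.right_pos 0).ne' (congrFun h0 0), ?_⟩
  rw [Matrix.sub_mulVec, Matrix.smul_mulVec, Matrix.one_mulVec, h.right_eigen, y, sub_self]

theorem dotProduct_vecMulVec_mulVec (ξ η a b : Fin m → ℝ) :
    ξ ⬝ᵥ (Matrix.vecMulVec a b *ᵥ η) = (ξ ⬝ᵥ a) * (b ⬝ᵥ η) := by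
  rw [Matrix.vecMulVec_mulVec]
  simp [dotProduct_smul, mul_comm]

theorem ξ_ne_zero {n : ℕ} {w : Word ℓ n} (hw : 0 < R.series w) : R.ξ ≠ 0 := by
  rintro h
  simp [series, h] at hw

theorem η_ne_zero {n : ℕ} {w : Word ℓ n} (hw : 0 < R.series w) : R.η ≠ 0 := by
  rintro h
  simp [series, h] at hw

theorem dotProduct_mulVec_pos {S : Matrix (Fin m) (Fin m) ℝ} (h0 : ∀ p q, 0 ≤ S p q) (hS : S ≠ 0)
    {a b : Fin m → ℝ} (ha : ∀ p, 0 < a p) (hb : ∀ p, 0 < b p) : 0 < a ⬝ᵥ (S *ᵥ b) := by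
  obtain ⟨p, q, hpq⟩ : ∃ p q, S p q ≠ 0 := by
    by_contra! h
    exact hS (Matrix.ext h)
  rw [dotProduct_mulVec_eq_sum]
  have hnn : ∀ p q, 0 ≤ a p * b q * S p q := fun p q =>
    mul_nonneg (mul_pos (ha p) (hb q)).le (h0 p q)
  exact Finset.sum_pos' (fun p _ => Finset.sum_nonneg fun q _ => hnn p q)
    ⟨p, Finset.mem_univ p, Finset.sum_pos' (fun q _ => hnn p q) ⟨q, Finset.mem_univ q,
      mul_pos (mul_pos (ha p) (hb q)) (lt_of_le_of_ne (h0 p q) (Ne.symm hpq))⟩⟩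

section Pairs

variable [NeZero m] {u v : (Fin ℓ → ℝ) → Fin m → ℝ}

theorem dotProduct_pos_of_pos {a b : Fin m → ℝ} (ha : ∀ p, 0 < a p) (hb : ∀ p, 0 < b p) :
    0 < a ⬝ᵥ b :=
  dotProduct_pos ha (fun p => (hb p).le) fun h => (hb 0).ne' (congrFun h 0)

/-- The right eigenvectors, normalized by `v_0' u_t = 1`. -/
def normalizedRight (u v : (Fin ℓ → ℝ) → Fin m → ℝ) (t : Fin ℓ → ℝ) : Fin m → ℝ :=
  (v 0 ⬝ᵥ u t)⁻¹ • u t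

variable (hM : R.M.IsPrimitive) (huv : ∀ t, IsPerronPair (R.Mt t) (u t) (v t))

include huv in
theorem dotProduct_normalizedRight (t : Fin ℓ → ℝ) : v 0 ⬝ᵥ normalizedRight u v t = 1 := by
  rw [normalizedRight, dotProduct_smul, smul_eq_mul,
    inv_mul_cancel₀ (dotProduct_pos_of_pos (huv 0).left_pos (huv t).right_pos).ne']

omit [NeZero m] in
include huv in
theorem normalizedRight_zero : normalizedRight u v 0 = u 0 := by
  rw [normalizedRight, (huv 0).normalized, inv_one, one_smul]

omit [NeZero m] in
include huv in
theorem Mt_mulVec_normalizedRight (t : Fin ℓ → ℝ) :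
    R.Mt t *ᵥ normalizedRight u v t = R.y t • normalizedRight u v t := by
  rw [normalizedRight, Matrix.mulVec_smul, (huv t).right_eigen, y, smul_comm]

-- The vectors `u_t` may be rescaled arbitrarily, even discontinuously, as `t` varies; normalizing
-- by the fixed functional `v_0'` removes this freedom.
include hM huv in
theorem contDiff_y_normalizedRight :
    ContDiff ℝ ω R.y ∧ ContDiff ℝ ω (normalizedRight u v) :=
  contDiff_perron R.matrixContDiff_Mt (R.isPrimitive_Mt hM)
    (fun t p => mul_pos (inv_pos.2 (dotProduct_pos_of_pos (huv 0).left_pos (huv t).right_pos))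
      ((huv t).right_pos p))
    (R.Mt_mulVec_normalizedRight huv) (R.dotProduct_normalizedRight huv)

-- Left eigenvectors are right eigenvectors of the transposes, so `contDiff_perron` applies again
-- with the functional `u_0'`.
include hM huv in
theorem contDiff_normalizedLeft : ContDiff ℝ ω fun t => (u 0 ⬝ᵥ v t)⁻¹ • v t := by
  refine (contDiff_perron (S := fun t => (R.Mt t)ᵀ) (a := u 0)
    (fun p q => R.matrixContDiff_Mt q p) (fun t => isPrimitive_transpose (R.isPrimitive_Mt hM t))
    (fun t p => mul_pos (inv_pos.2 (dotProduct_pos_of_pos (huv 0).right_pos (huv t).left_pos))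
      ((huv t).left_pos p)) (fun t => ?_) fun t => ?_).2
  · change _ *ᵥ ((u 0 ⬝ᵥ v t)⁻¹ • v t) = _ • ((u 0 ⬝ᵥ v t)⁻¹ • v t)
    rw [perronRoot_transpose (R.isPrimitive_Mt hM t), Matrix.mulVec_transpose, Matrix.smul_vecMul,
      (huv t).left_eigen, smul_comm]
  · change u 0 ⬝ᵥ ((u 0 ⬝ᵥ v t)⁻¹ • v t) = 1
    rw [dotProduct_smul, smul_eq_mul,
      inv_mul_cancel₀ (dotProduct_pos_of_pos (huv 0).right_pos (huv t).left_pos).ne']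

/-- The projection `u_t v_t'` on the Perron-Frobenius eigenspace is analytic. -/
theorem matrixContDiff_vecMulVec (hM : R.M.IsPrimitive)
    (huv : ∀ t, IsPerronPair (R.Mt t) (u t) (v t)) :
    MatrixContDiff fun t => Matrix.vecMulVec (u t) (v t) := fun p q => by
  have hU := (R.contDiff_y_normalizedRight hM huv).2
  have hV := R.contDiff_normalizedLeft hM huv
  have ha : ∀ t, 0 < v 0 ⬝ᵥ u t := fun t =>
    dotProduct_pos_of_pos (huv 0).left_pos (huv t).right_pos
  have hb : ∀ t, 0 < u 0 ⬝ᵥ v t := fun t =>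
    dotProduct_pos_of_pos (huv 0).right_pos (huv t).left_pos
  set V := fun t => (u 0 ⬝ᵥ v t)⁻¹ • v t with hVdef
  -- Neither scaling factor need be analytic, but their product is: it is the inverse of the pairing
  -- of the two normalized vectors.
  have hVU : ∀ t, V t ⬝ᵥ normalizedRight u v t = ((v 0 ⬝ᵥ u t) * (u 0 ⬝ᵥ v t))⁻¹ := fun t => by
    simp only [hVdef, normalizedRight, smul_dotProduct, dotProduct_smul, (huv t).normalized,
      smul_eq_mul, mul_one, mul_inv]
  have h : (fun t => Matrix.vecMulVec (u t) (v t) p q) = fun t =>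
      (V t ⬝ᵥ normalizedRight u v t)⁻¹ * (normalizedRight u v t p * V t q) := by
    funext t
    have h1 := (ha t).ne'
    have h2 := (hb t).ne'
    rw [hVU, inv_inv]
    simp only [hVdef, normalizedRight, Matrix.vecMulVec_apply, Pi.smul_apply, smul_eq_mul]
    field_simp
  rw [h]
  have hUp : ∀ p, ContDiff ℝ ω fun t => normalizedRight u v t p := contDiff_pi.1 hU
  have hVp : ∀ p, ContDiff ℝ ω fun t => V t p := contDiff_pi.1 hV
  refine ContDiff.mul (ContDiff.inv ?_ fun t => ?_) ((hUp p).mul (hVp q))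
  · simp only [dotProduct]
    exact ContDiff.sum fun k _ => (hVp k).mul (hUp k)
  · rw [hVU]
    exact inv_ne_zero (mul_pos (ha t) (hb t)).ne'

variable (hξ : R.ξ ≠ 0) (hη : R.η ≠ 0)

omit [NeZero m] in
include huv hξ hη in
theorem numerator_pos (t : Fin ℓ → ℝ) : 0 < (R.ξ ⬝ᵥ u t) * (v t ⬝ᵥ R.η) := by
  rw [dotProduct_comm]
  exact mul_pos (dotProduct_pos (huv t).right_pos R.ξ_nonneg hξ)
    (dotProduct_pos (huv t).left_pos R.η_nonneg hη)

omit [NeZero m] in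
include huv hξ hη in
theorem r_pos (t : Fin ℓ → ℝ) : 0 < R.r u v t :=
  div_pos (R.numerator_pos huv hξ hη t) (R.numerator_pos huv hξ hη 0)

omit [NeZero m] in
include huv hξ hη in
theorem r_zero : R.r u v 0 = 1 := div_self (R.numerator_pos huv hξ hη 0).ne'

include hM huv in
theorem contDiff_r : ContDiff ℝ ω (R.r u v) := by
  have h := ((R.matrixContDiff_vecMulVec hM huv).dotProduct_mulVec R.ξ R.η).div_const
    ((R.ξ ⬝ᵥ u 0) * (v 0 ⬝ᵥ R.η))
  simp only [dotProduct_vecMulVec_mulVec] at h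
  exact h

include hM huv in
/-- Derivative of the eigenvalue equation. -/
theorem deriv_eigen (i : Fin ℓ) (p : Fin m) :
    (fun t => ∑ q, (Real.exp (t i) * R.A i p q * normalizedRight u v t q +
      R.Mt t p q * partialDeriv i (fun s => normalizedRight u v s q) t)) =
    fun t => partialDeriv i R.y t * normalizedRight u v t p +
      R.y t * partialDeriv i (fun s => normalizedRight u v s p) t := by
  obtain ⟨hy, hU⟩ := R.contDiff_y_normalizedRight hM huv
  have hUp : ∀ p, ContDiff ℝ ω fun t => normalizedRight u v t p := contDiff_pi.1 hU
  have h : (fun t => ∑ q, R.Mt t p q * normalizedRight u v t q) =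
      fun t => R.y t * normalizedRight u v t p :=
    funext fun t => congrFun (R.Mt_mulVec_normalizedRight huv t) p
  have h2 := congrArg (partialDeriv i) h
  rw [partialDeriv_sum i _ fun q => (R.matrixContDiff_Mt p q).mul (hUp q),
    partialDeriv_mul i hy (hUp p)] at h2
  rw [← h2]
  refine funext fun t => Finset.sum_congr rfl fun q _ => ?_
  rw [partialDeriv_mul i (R.matrixContDiff_Mt p q) (hUp q), partialDeriv_Mt_apply]

-- With `w` the derivative of the normalized eigenvector, this is the Poisson equation `hw` of
-- `sum_sq_increments`.
include hM huv in
theorem deriv_eigen_zero (i : Fin ℓ) :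
    R.A i *ᵥ u 0 + R.M *ᵥ (fun q => partialDeriv i (fun s => normalizedRight u v s q) 0) =
      partialDeriv i R.y 0 • u 0 +
        perronRoot R.M • fun q => partialDeriv i (fun s => normalizedRight u v s q) 0 := by
  ext p
  have h := congrFun (R.deriv_eigen hM huv i p) 0
  simp only [normalizedRight_zero R huv, Pi.zero_apply, Real.exp_zero, one_mul, Mt_zero,
    Finset.sum_add_distrib, y_zero] at h
  exact h

include hM huv in
theorem deriv_deriv_eigen_zero (i : Fin ℓ) :
    R.A i *ᵥ u 0 + (2 : ℝ) • (R.A i *ᵥ fun q => partialDeriv i (fun s => normalizedRight u v s q) 0)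
      + R.M *ᵥ (fun q => partialDeriv i (partialDeriv i fun s => normalizedRight u v s q) 0) =
      partialDeriv i (partialDeriv i R.y) 0 • u 0 +
        (2 * partialDeriv i R.y 0) • (fun q => partialDeriv i (fun s => normalizedRight u v s q) 0) +
        perronRoot R.M • fun q =>
          partialDeriv i (partialDeriv i fun s => normalizedRight u v s q) 0 := by
  ext p
  obtain ⟨hy, hU⟩ := R.contDiff_y_normalizedRight hM huv
  have hUp : ∀ p, ContDiff ℝ ω fun t => normalizedRight u v t p := contDiff_pi.1 hU
  have hUd : ∀ p, ContDiff ℝ ω (partialDeriv i fun t => normalizedRight u v t p) :=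
    fun p => contDiff_partialDeriv i (hUp p)
  have hyd := contDiff_partialDeriv i hy
  have hexp : ∀ q, ContDiff ℝ ω fun t : Fin ℓ → ℝ => Real.exp (t i) * R.A i p q :=
    fun q => by fun_prop
  have h := congrArg (partialDeriv i) (R.deriv_eigen hM huv i p)
  rw [partialDeriv_sum i _ fun q => ((hexp q).mul (hUp q)).add
    ((R.matrixContDiff_Mt p q).mul (hUd q)),
    partialDeriv_add i (hyd.mul (hUp p)) (hy.mul (hUd p)), partialDeriv_mul i hyd (hUp p),
    partialDeriv_mul i hy (hUd p)] at h
  have h0 := congrFun h 0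
  have hq : ∀ q, partialDeriv i (fun t => Real.exp (t i) * R.A i p q * normalizedRight u v t q +
      R.Mt t p q * partialDeriv i (fun s => normalizedRight u v s q) t) 0 =
      R.A i p q * u 0 q + 2 * (R.A i p q * partialDeriv i (fun s => normalizedRight u v s q) 0) +
      R.M p q * partialDeriv i (partialDeriv i fun s => normalizedRight u v s q) 0 := by
    intro q
    have hA : partialDeriv i (fun t : Fin ℓ → ℝ => Real.exp (t i) * R.A i p q) =
        fun t => Real.exp (t i) * R.A i p q := by
      rw [partialDeriv_mul_const i _ (by fun_prop), partialDeriv_exp i (contDiff_apply ℝ ℝ i)]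
      funext t
      beta_reduce
      rw [partialDeriv_eq_of_hasFDerivAt i (hasFDerivAt_apply i t)]
      simp
    rw [partialDeriv_add i ((hexp q).mul (hUp q)) ((R.matrixContDiff_Mt p q).mul (hUd q)),
      partialDeriv_mul i (hexp q) (hUp q), partialDeriv_mul i (R.matrixContDiff_Mt p q) (hUd q),
      partialDeriv_Mt_apply, hA]
    simp only [normalizedRight_zero R huv, Pi.zero_apply, Real.exp_zero, one_mul, Mt_zero]
    ring
  simp only [hq, normalizedRight_zero R huv, y_zero, Finset.sum_add_distrib,
    ← Finset.mul_sum] at h0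
  simp only [Pi.add_apply, Pi.smul_apply, smul_eq_mul, Matrix.mulVec, dotProduct]
  rw [h0]
  ring

-- Obtained by differentiating the constant `v_0' u_t = 1` for the normalized vectors. It centres
-- `w` and removes the first-order cross term in `partialDeriv_partialDeriv_y`.
include hM huv in
theorem dotProduct_deriv_normalizedRight (i : Fin ℓ) :
    v 0 ⬝ᵥ (fun q => partialDeriv i (fun s => normalizedRight u v s q) 0) = 0 := by
  have hUp : ∀ p, ContDiff ℝ ω fun t => normalizedRight u v t p :=
    contDiff_pi.1 (R.contDiff_y_normalizedRight hM huv).2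
  have h : (fun t => ∑ q, v 0 q * normalizedRight u v t q) = fun _ => 1 :=
    funext fun t => R.dotProduct_normalizedRight huv t
  have h2 := congrArg (partialDeriv i) h
  rw [partialDeriv_const, partialDeriv_sum i _ fun q => contDiff_const.mul (hUp q)] at h2
  have h3 := congrFun h2 0
  rw [← h3]
  exact Finset.sum_congr rfl fun q _ => by rw [partialDeriv_const_mul i _ (hUp q)]

omit [NeZero m] in
include huv in
theorem vecMul_M : v 0 ᵥ* R.M = perronRoot R.M • v 0 := by
  rw [← Mt_zero]; exact (huv 0).left_eigen

omit [NeZero m] in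
include huv in
theorem M_mulVec : R.M *ᵥ u 0 = perronRoot R.M • u 0 := by
  rw [← Mt_zero]; exact (huv 0).right_eigen

omit [NeZero m] in
include huv in
theorem dotProduct_M_mulVec (x : Fin m → ℝ) :
    v 0 ⬝ᵥ (R.M *ᵥ x) = perronRoot R.M * (v 0 ⬝ᵥ x) := by
  rw [Matrix.dotProduct_mulVec, R.vecMul_M huv, smul_dotProduct, smul_eq_mul]

-- Pairing the differentiated equation with `v_0'` cancels the unknown derivative of the
-- eigenvector.
include hM huv in
theorem partialDeriv_y (i : Fin ℓ) : partialDeriv i R.y 0 = v 0 ⬝ᵥ (R.A i *ᵥ u 0) := by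
  have h := congrArg (fun x => v 0 ⬝ᵥ x) (R.deriv_eigen_zero hM huv i)
  simp only [dotProduct_add, dotProduct_smul, R.dotProduct_M_mulVec huv, smul_eq_mul,
    (huv 0).normalized] at h
  linarith

include hM huv in
theorem partialDeriv_partialDeriv_y (i : Fin ℓ) : partialDeriv i (partialDeriv i R.y) 0 =
    partialDeriv i R.y 0 + 2 * (v 0 ⬝ᵥ (R.A i *ᵥ
      fun q => partialDeriv i (fun s => normalizedRight u v s q) 0)) := by
  have h := congrArg (fun x => v 0 ⬝ᵥ x) (R.deriv_deriv_eigen_zero hM huv i)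
  simp only [dotProduct_add, dotProduct_smul, R.dotProduct_M_mulVec huv, smul_eq_mul,
    (huv 0).normalized, R.dotProduct_deriv_normalizedRight hM huv, ← R.partialDeriv_y hM huv] at h
  linarith

theorem perronRoot_pos (hM : R.M.IsPrimitive) : 0 < perronRoot R.M :=
  (exists_isPerronPair hM).1

include hM huv in
theorem β_eq (i : Fin ℓ) : R.β i = (v 0 ⬝ᵥ (R.A i *ᵥ u 0)) / perronRoot R.M := by
  rw [β, R.partialDeriv_y hM huv]

include hM huv in
theorem β_pos (i : Fin ℓ) : 0 < R.β i := by
  rw [R.β_eq hM huv]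
  exact div_pos (dotProduct_mulVec_pos (R.A_nonneg i) (R.A_ne_zero i) (huv 0).left_pos
    (huv 0).right_pos) (R.perronRoot_pos hM)

-- The numbers `v'A_i u` and `v'B u` add up to `λ`, and the last one is positive because `B ≠ 0`.
include hM huv in
theorem sum_β_lt_one : ∑ i, R.β i < 1 := by
  have h1 : ∑ i, v 0 ⬝ᵥ (R.A i *ᵥ u 0) + v 0 ⬝ᵥ (R.B *ᵥ u 0) = perronRoot R.M := by
    rw [← dotProduct_sum, ← dotProduct_add, ← Matrix.sum_mulVec, ← Matrix.add_mulVec, ← M,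
      R.dotProduct_M_mulVec huv, (huv 0).normalized, mul_one]
  have h2 := dotProduct_mulVec_pos R.B_nonneg R.B_ne_zero (huv 0).left_pos (huv 0).right_pos
  simp only [R.β_eq hM huv, ← Finset.sum_div]
  rw [div_lt_one (R.perronRoot_pos hM)]
  linarith

include hM huv in
theorem β_lt_one (i : Fin ℓ) : R.β i < 1 :=
  (Finset.single_le_sum (f := R.β) (fun j _ => (R.β_pos hM huv j).le)
    (Finset.mem_univ i)).trans_lt (R.sum_β_lt_one hM huv)

end Pairs
end LinearRepresentation

/-! ### Logarithmic derivatives of quasi-powers. -/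

section Asymptotics

theorem isBigO_quadratic (c₀ c₁ c₂ : ℝ) :
    (fun n : ℕ => c₀ + c₁ * n + c₂ * (n : ℝ) ^ 2) =O[atTop] fun n : ℕ => (n : ℝ) ^ 2 := by
  refine IsBigO.of_bound (|c₀| + |c₁| + |c₂|) ((eventually_ge_atTop 1).mono fun n hn => ?_)
  have h1 : (1 : ℝ) ≤ n := by exact_mod_cast hn
  have h2 : (n : ℝ) ≤ (n : ℝ) ^ 2 := le_self_pow₀ h1 two_ne_zero
  rw [Real.norm_eq_abs, Real.norm_of_nonneg (sq_nonneg (n : ℝ))]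
  calc |c₀ + c₁ * n + c₂ * (n : ℝ) ^ 2| ≤ |c₀| + |c₁ * n| + |c₂ * (n : ℝ) ^ 2| := abs_add_three _ _ _
    _ = |c₀| * 1 + |c₁| * n + |c₂| * (n : ℝ) ^ 2 := by
        rw [abs_mul, abs_mul, Nat.abs_cast, abs_of_nonneg (sq_nonneg (n : ℝ)), mul_one]
    _ ≤ |c₀| * (n : ℝ) ^ 2 + |c₁| * (n : ℝ) ^ 2 + |c₂| * (n : ℝ) ^ 2 := by
        gcongr
        exact h1.trans h2
    _ = _ := by ring

/-- The difference is `(a - b - b e) / (1 + e)`, and `b` grows only polynomially. -/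
theorem ExpSmall.div_one_add {a b e : ℕ → ℝ} {k : ℕ} (hab : ExpSmall fun n => a n - b n)
    (hb : b =O[atTop] fun n : ℕ => (n : ℝ) ^ k) (he : ExpSmall e) :
    ExpSmall fun n => a n / (1 + e n) - b n := by
  have hlim : Tendsto (fun n => 1 + e n) atTop (𝓝 1) := by
    simpa using he.tendsto.const_add 1
  have hinv : (fun n => (1 + e n)⁻¹) =O[atTop] fun n : ℕ => (n : ℝ) ^ 0 := by
    simpa using (hlim.inv₀ one_ne_zero).isBigO_one ℝ
  refine ((hab.sub (he.mul_isBigO hb)).mul_isBigO hinv).congr ?_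
  filter_upwards [hlim.eventually_ne one_ne_zero] with n hn
  field_simp
  ring

theorem ExpSmall.mul_sub_mul {a b a' b' : ℕ → ℝ} {k : ℕ} (hab : ExpSmall fun n => a n - b n)
    (hab' : ExpSmall fun n => a' n - b' n) (hb : b =O[atTop] fun n : ℕ => (n : ℝ) ^ k)
    (hb' : b' =O[atTop] fun n : ℕ => (n : ℝ) ^ k) :
    ExpSmall fun n => a n * a' n - b n * b' n := by
  have h0 : (fun n => a n - b n) =O[atTop] fun n : ℕ => (n : ℝ) ^ 0 := by
    simpa using hab.tendsto.isBigO_one ℝ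
  refine (((hab'.mul_isBigO h0).add (hab.mul_isBigO hb')).add (hab'.mul_isBigO hb)).congr
    (Eventually.of_forall fun n => ?_)
  ring

variable {ℓ : ℕ}

/-- Logarithmic derivatives at `0` of a quasi-power `Y ^ n * r + E n`. -/
theorem expSmall_quasiPower {Y r : (Fin ℓ → ℝ) → ℝ} (hY : ContDiff ℝ ω Y) (hr : ContDiff ℝ ω r)
    (hY0 : Y 0 = 1) (hr0 : r 0 = 1) {E H : ℕ → (Fin ℓ → ℝ) → ℝ} (hE : ∀ n, ContDiff ℝ ω (E n))
    (hE0 : ExpSmall fun n => E n 0) (hE1 : ∀ i, ExpSmall fun n => partialDeriv i (E n) 0)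
    (hE2 : ∀ i j, ExpSmall fun n => partialDeriv i (partialDeriv j (E n)) 0)
    (hH : ∀ n, 0 < n → H n = fun t => Y t ^ n * r t + E n t) :
    (∀ i, ExpSmall fun n => partialDeriv i (H n) 0 / H n 0 -
      (n * partialDeriv i Y 0 + partialDeriv i r 0)) ∧
    ∀ i j, ExpSmall fun n => partialDeriv i (partialDeriv j (H n)) 0 / H n 0 -
      partialDeriv i (H n) 0 / H n 0 * (partialDeriv j (H n) 0 / H n 0) -
      (n * (partialDeriv i (partialDeriv j Y) 0 - partialDeriv i Y 0 * partialDeriv j Y 0) +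
        (partialDeriv i (partialDeriv j r) 0 - partialDeriv i r 0 * partialDeriv j r 0)) := by
  have hH0 : ∀ n, 0 < n → H n 0 = 1 + E n 0 := fun n hn => by
    simp [hH n hn, hY0, hr0]
  have hH1 : ∀ n, 0 < n → ∀ i, partialDeriv i (H n) = fun t =>
      n * (Y t ^ (n - 1) * (partialDeriv i Y t * r t)) + Y t ^ n * partialDeriv i r t +
        partialDeriv i (E n) t := fun n hn i => by
    rw [hH n hn, partialDeriv_add i ((hY.pow n).mul hr) (hE n), partialDeriv_mul i (hY.pow n) hr,
      partialDeriv_pow i hY]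
    funext t
    ring
  have hH1' : ∀ n, 0 < n → ∀ i, partialDeriv i (H n) 0 =
      n * partialDeriv i Y 0 + partialDeriv i r 0 + partialDeriv i (E n) 0 := fun n hn i => by
    rw [hH1 n hn]
    simp [hY0, hr0]
  have hH2 : ∀ n, 0 < n → ∀ i j, partialDeriv i (partialDeriv j (H n)) 0 =
      n * ((n - 1) * partialDeriv i Y 0 * partialDeriv j Y 0 + partialDeriv i (partialDeriv j Y) 0 +
        partialDeriv j Y 0 * partialDeriv i r 0 + partialDeriv i Y 0 * partialDeriv j r 0) +
        partialDeriv i (partialDeriv j r) 0 + partialDeriv i (partialDeriv j (E n)) 0 :=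
    fun n hn i j => by
    have hYj := contDiff_partialDeriv j hY
    have hrj := contDiff_partialDeriv j hr
    have hEj := contDiff_partialDeriv j (hE n)
    rw [hH1 n hn, partialDeriv_add i ((contDiff_const.mul ((hY.pow (n - 1)).mul (hYj.mul hr))).add
      ((hY.pow n).mul hrj)) hEj,
      partialDeriv_add i (contDiff_const.mul ((hY.pow (n - 1)).mul (hYj.mul hr)))
        ((hY.pow n).mul hrj),
      partialDeriv_const_mul i _ ((hY.pow (n - 1)).mul (hYj.mul hr)),
      partialDeriv_mul i (hY.pow (n - 1)) (hYj.mul hr), partialDeriv_mul i hYj hr,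
      partialDeriv_mul i (hY.pow n) hrj, partialDeriv_pow i hY, partialDeriv_pow i hY]
    simp only [hY0, hr0, one_pow]
    rw [Nat.cast_sub hn]
    push_cast
    ring
  have hO1 : ∀ i, (fun n : ℕ => n * partialDeriv i Y 0 + partialDeriv i r 0) =O[atTop]
      fun n : ℕ => (n : ℝ) ^ 2 := fun i => by
    refine (isBigO_quadratic (partialDeriv i r 0) (partialDeriv i Y 0) 0).congr_left fun n => ?_
    ring
  have hS1 : ∀ i, ExpSmall fun n => partialDeriv i (H n) 0 / H n 0 -
      (n * partialDeriv i Y 0 + partialDeriv i r 0) := fun i => by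
    have h1 : ExpSmall fun n => partialDeriv i (H n) 0 -
        (n * partialDeriv i Y 0 + partialDeriv i r 0) := by
      refine (hE1 i).congr ((eventually_gt_atTop 0).mono fun n hn => ?_)
      beta_reduce
      rw [hH1' n hn]
      ring
    refine (h1.div_one_add (hO1 i) hE0).congr ((eventually_gt_atTop 0).mono fun n hn => ?_)
    beta_reduce
    rw [hH0 n hn]
  refine ⟨hS1, fun i j => ?_⟩
  set b : ℕ → ℝ := fun n =>
    n * ((n - 1) * partialDeriv i Y 0 * partialDeriv j Y 0 + partialDeriv i (partialDeriv j Y) 0 +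
        partialDeriv j Y 0 * partialDeriv i r 0 + partialDeriv i Y 0 * partialDeriv j r 0) +
        partialDeriv i (partialDeriv j r) 0 with hb
  have hO2 : b =O[atTop] fun n : ℕ => (n : ℝ) ^ 2 := by
    refine (isBigO_quadratic (partialDeriv i (partialDeriv j r) 0)
      (-(partialDeriv i Y 0 * partialDeriv j Y 0) + partialDeriv i (partialDeriv j Y) 0 +
        partialDeriv j Y 0 * partialDeriv i r 0 + partialDeriv i Y 0 * partialDeriv j r 0)
      (partialDeriv i Y 0 * partialDeriv j Y 0)).congr_left fun n => ?_
    simp only [hb]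
    ring
  have hS2 : ExpSmall fun n => partialDeriv i (partialDeriv j (H n)) 0 / H n 0 - b n := by
    have h1 : ExpSmall fun n => partialDeriv i (partialDeriv j (H n)) 0 - b n := by
      refine (hE2 i j).congr ((eventually_gt_atTop 0).mono fun n hn => ?_)
      beta_reduce
      rw [hH2 n hn]
      simp only [hb]
      ring
    refine (h1.div_one_add hO2 hE0).congr ((eventually_gt_atTop 0).mono fun n hn => ?_)
    beta_reduce
    rw [hH0 n hn]
  -- Subtracting the product of the two linear main terms from `b` cancels the `n ^ 2` term and the
  -- mixed terms.
  refine (hS2.sub ((hS1 i).mul_sub_mul (hS1 j) (hO1 i) (hO1 j))).congr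
    (Eventually.of_forall fun n => ?_)
  simp only [hb]
  ring

end Asymptotics

/-! ### The generating function as a quasi-power. -/

namespace LinearRepresentation

variable {ℓ m : ℕ} (R : LinearRepresentation ℓ m) [NeZero m] {u v : (Fin ℓ → ℝ) → Fin m → ℝ}
  (hM : R.M.IsPrimitive) (huv : ∀ t, IsPerronPair (R.Mt t) (u t) (v t))

/-- The part of `M(t) / λ` that is complementary to the Perron-Frobenius eigenvalue. -/
def residual (u v : (Fin ℓ → ℝ) → Fin m → ℝ) (t : Fin ℓ → ℝ) : Matrix (Fin m) (Fin m) ℝ :=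
  (perronRoot R.M)⁻¹ • (R.Mt t - R.y t • Matrix.vecMulVec (u t) (v t))

include hM huv in
theorem matrixContDiff_residual : MatrixContDiff (R.residual u v) := fun p q => by
  simp only [residual, Matrix.smul_apply, Matrix.sub_apply, smul_eq_mul]
  exact contDiff_const.mul ((R.matrixContDiff_Mt p q).sub
    ((R.contDiff_y_normalizedRight hM huv).1.mul (R.matrixContDiff_vecMulVec hM huv p q)))

-- At `t = 0` the residual is `M / λ - u v'`, and `M / λ` is primitive with Perron-Frobenius
-- eigenvalue `1`.
attribute [local instance] Matrix.linftyOpNormedRing in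
include hM huv in
theorem expSmall_residual_pow : ExpSmall fun n => R.residual u v 0 ^ n := by
  have hpos := R.perronRoot_pos hM
  have hprim : ((perronRoot R.M)⁻¹ • R.M).IsPrimitive :=
    isPrimitive_of_smul_le hM (inv_pos.2 hpos) fun p q => le_rfl
  obtain ⟨C, ρ, -, h0, h1, hbd⟩ := exists_geometric_bound hprim (huv 0).right_pos (huv 0).left_pos
    (by rw [Matrix.smul_mulVec, R.M_mulVec huv, smul_smul, inv_mul_cancel₀ hpos.ne', one_smul])
    (by rw [Matrix.vecMul_smul, R.vecMul_M huv, smul_smul, inv_mul_cancel₀ hpos.ne', one_smul])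
    (huv 0).normalized
  have h : R.residual u v 0 = (perronRoot R.M)⁻¹ • R.M - Matrix.vecMulVec (u 0) (v 0) := by
    rw [residual, Mt_zero, y_zero, smul_sub, smul_smul, inv_mul_cancel₀ hpos.ne', one_smul]
  rw [h]
  exact ExpSmall.of_bound h0 h1 hbd

-- Powers of `M(t)` split along the idempotent `u_t v_t'`. The case `n = 0` is excluded: there the
-- zeroth power of the residual is the identity, and the projection would be counted twice.
include hM huv in
theorem genFun_eq (hξ : R.ξ ≠ 0) (hη : R.η ≠ 0) {n : ℕ} (hn : 0 < n) :
    R.genFun n = fun t => perronRoot R.M ^ n * ((R.ξ ⬝ᵥ u 0) * (v 0 ⬝ᵥ R.η)) *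
      (((perronRoot R.M)⁻¹ * R.y t) ^ n * R.r u v t +
        ((R.ξ ⬝ᵥ u 0) * (v 0 ⬝ᵥ R.η))⁻¹ • R.ξ ⬝ᵥ (R.residual u v t ^ n *ᵥ R.η)) := by
  have hpos := R.perronRoot_pos hM
  have hg := R.numerator_pos huv hξ hη 0
  funext t
  set P := Matrix.vecMulVec (u t) (v t) with hP
  have h1 : R.Mt t * P = R.y t • P := by
    rw [hP, Matrix.mul_vecMulVec, (huv t).right_eigen, Matrix.smul_vecMulVec]; rfl
  have h2 : P * R.Mt t = R.y t • P := by
    rw [hP, Matrix.vecMulVec_mul, (huv t).left_eigen, Matrix.vecMulVec_smul]; rfl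
  have h3 := sub_smul_idempotent_pow h1 h2 (vecMulVec_mul_self (huv t).normalized) hn
  have h4 : R.Mt t ^ n = R.y t ^ n • P + perronRoot R.M ^ n • R.residual u v t ^ n := by
    rw [residual, smul_pow, smul_smul, ← mul_pow, mul_inv_cancel₀ hpos.ne', one_pow, one_smul, h3]
    abel
  rw [genFun, h4, Matrix.add_mulVec, Matrix.smul_mulVec, Matrix.smul_mulVec, dotProduct_add,
    dotProduct_smul, dotProduct_smul, hP, dotProduct_vecMulVec_mulVec, r, smul_dotProduct]
  simp only [smul_eq_mul]
  rw [mul_pow, inv_pow]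
  have h5 := hg.ne'
  field_simp
  rw [eq_div_iff h5]
  ring

include hM huv in
/-- Asymptotics of the logarithmic derivatives of the moment generating functions. -/
theorem expSmall_genFun (hξ : R.ξ ≠ 0) (hη : R.η ≠ 0) :
    (∀ i, ExpSmall fun n => partialDeriv i (R.genFun n) 0 / R.genFun n 0 -
      (n * R.β i + R.c u v i)) ∧
    ∀ i j, ExpSmall fun n => partialDeriv i (partialDeriv j (R.genFun n)) 0 / R.genFun n 0 -
      partialDeriv i (R.genFun n) 0 / R.genFun n 0 *
        (partialDeriv j (R.genFun n) 0 / R.genFun n 0) -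
      (n * R.Γ i j + R.C u v i j) := by
  have hpos := R.perronRoot_pos hM
  have hg := R.numerator_pos huv hξ hη 0
  have hy := (R.contDiff_y_normalizedRight hM huv).1
  have hr := R.contDiff_r hM huv
  have hQ := R.matrixContDiff_residual hM huv
  set g := (R.ξ ⬝ᵥ u 0) * (v 0 ⬝ᵥ R.η) with hgdef
  set E : ℕ → (Fin ℓ → ℝ) → ℝ := fun n t => g⁻¹ • R.ξ ⬝ᵥ (R.residual u v t ^ n *ᵥ R.η) with hEdef
  have hEc : ∀ n, ContDiff ℝ ω (E n) := fun n => (hQ.pow n).dotProduct_mulVec _ _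
  have hYc : ContDiff ℝ ω fun t => (perronRoot R.M)⁻¹ * R.y t := contDiff_const.mul hy
  have hY0 : (perronRoot R.M)⁻¹ * R.y 0 = 1 := by rw [y_zero, inv_mul_cancel₀ hpos.ne']
  obtain ⟨hE0, hE1, hE2⟩ := expSmall_bilinear hQ (R.expSmall_residual_pow hM huv) (g⁻¹ • R.ξ) R.η
  set H : ℕ → (Fin ℓ → ℝ) → ℝ := fun n t =>
    ((perronRoot R.M)⁻¹ * R.y t) ^ n * R.r u v t + E n t with hHdef
  have hHc : ∀ n, ContDiff ℝ ω (H n) := fun n => ((hYc.pow n).mul hr).add (hEc n)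
  obtain ⟨h1, h2⟩ := expSmall_quasiPower hYc hr hY0 (R.r_zero huv hξ hη) hEc hE0 hE1 hE2
    (H := H) fun n _ => rfl
  have hF : ∀ n, 0 < n → R.genFun n = fun t => perronRoot R.M ^ n * g * H n t :=
    fun n hn => R.genFun_eq hM huv hξ hη hn
  have hk : ∀ n, perronRoot R.M ^ n * g ≠ 0 := fun n => (mul_pos (pow_pos hpos n) hg).ne'
  -- The factor `λ ^ n g` does not depend on `t`, so it cancels in every quotient.
  have hF0 : ∀ n, 0 < n → ∀ a : ℝ, perronRoot R.M ^ n * g * a / R.genFun n 0 = a / H n 0 :=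
    fun n hn a => by rw [hF n hn]; exact mul_div_mul_left _ _ (hk n)
  have hF1 : ∀ n, 0 < n → ∀ i, partialDeriv i (R.genFun n) =
      fun t => perronRoot R.M ^ n * g * partialDeriv i (H n) t := fun n hn i => by
    rw [hF n hn, partialDeriv_const_mul i _ (hHc n)]
  have hF2 : ∀ n, 0 < n → ∀ i j, partialDeriv i (partialDeriv j (R.genFun n)) =
      fun t => perronRoot R.M ^ n * g * partialDeriv i (partialDeriv j (H n)) t :=
    fun n hn i j => by
    rw [hF1 n hn, partialDeriv_const_mul i _ (contDiff_partialDeriv j (hHc n))]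
  have hdY : ∀ i, partialDeriv i (fun t => (perronRoot R.M)⁻¹ * R.y t) =
      fun t => (perronRoot R.M)⁻¹ * partialDeriv i R.y t := fun i =>
    partialDeriv_const_mul i _ hy
  refine ⟨fun i => (h1 i).congr ((eventually_gt_atTop 0).mono fun n hn => ?_),
    fun i j => (h2 i j).congr ((eventually_gt_atTop 0).mono fun n hn => ?_)⟩
  · beta_reduce
    rw [hF1 n hn, hF0 n hn, hdY, β, c]
    ring
  · beta_reduce
    rw [hF2 n hn, hF1 n hn, hF1 n hn, hF0 n hn, hF0 n hn, hF0 n hn, hdY, hdY,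
      partialDeriv_const_mul i _ (contDiff_partialDeriv j hy), Γ, C,
      hessian_log i j hy fun t => (R.y_pos hM t).ne',
      hessian_log i j hr fun t => (R.r_pos huv hξ hη t).ne', R.r_zero huv hξ hη, y_zero]
    ring

end LinearRepresentation

/-! ### Positivity of the asymptotic variance. -/

section Variance

variable {m : ℕ} {A T : Matrix (Fin m) (Fin m) ℝ} {u v w : Fin m → ℝ} {lam β : ℝ}

/-- The asymptotic variance as a sum of squares of the increments of the martingale obtained from
the counting function by adding the solution `w_p / u_p` of the Poisson equation. -/
theorem sum_sq_increments (hu : ∀ p, 0 < u p) (hTu : T *ᵥ u = lam • u) (hTv : v ᵥ* T = lam • v)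
    (hvu : v ⬝ᵥ u = 1) (hvw : v ⬝ᵥ w = 0)
    (hw : A *ᵥ u + T *ᵥ w = (lam * β) • u + lam • w) :
    ∑ p, ∑ q, v p * u q * (A p q * (1 - β + w q / u q - w p / u p) ^ 2 +
      (T p q - A p q) * (-β + w q / u q - w p / u p) ^ 2) =
      lam * β + 2 * (v ⬝ᵥ (A *ᵥ w)) - lam * β ^ 2 := by
  set h : Fin m → ℝ := fun p => w p / u p with hh
  have hw' : ∀ p, w p = u p * h p := fun p => by
    have := (hu p).ne'
    simp only [hh]; field_simp
  -- Absorbing `h` and `h ^ 2` into the left or right vector turns every term of the expanded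
  -- squares into a bilinear form in `A` or `T`.
  set a : Fin m → ℝ := fun p => v p * h p with ha
  set b : Fin m → ℝ := fun p => v p * h p ^ 2 with hb
  set d : Fin m → ℝ := fun p => u p * h p ^ 2 with hd
  have hTx : ∀ x, v ⬝ᵥ (T *ᵥ x) = lam * (v ⬝ᵥ x) := fun x => by
    rw [Matrix.dotProduct_mulVec, hTv, smul_dotProduct, smul_eq_mul]
  have hxT : ∀ x, x ⬝ᵥ (T *ᵥ u) = lam * (x ⬝ᵥ u) := fun x => by
    rw [hTu, dotProduct_smul, smul_eq_mul]
  have hau : a ⬝ᵥ u = 0 := by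
    rw [← hvw]
    exact Finset.sum_congr rfl fun p _ => by rw [hw' p]; simp only [ha]; ring
  have haw : a ⬝ᵥ w = v ⬝ᵥ d :=
    Finset.sum_congr rfl fun p _ => by rw [hw' p]; simp only [ha, hd]; ring
  have hbu : b ⬝ᵥ u = v ⬝ᵥ d :=
    Finset.sum_congr rfl fun p _ => by simp only [hb, hd]; ring
  -- Pairing with `v` gives `v'A u = lam β`. Pairing with `a` gives `a'A u + a'T w = lam v'd`, which
  -- cancels the two terms coming from `h ^ 2`.
  have e1 := congrArg (fun x => v ⬝ᵥ x) hw
  have e2 := congrArg (fun x => a ⬝ᵥ x) hw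
  simp only [dotProduct_add, dotProduct_smul, hTx, hvw, hvu, smul_eq_mul] at e1
  simp only [dotProduct_add, dotProduct_smul, hau, haw, smul_eq_mul] at e2
  have key : ∑ p, ∑ q, v p * u q * (A p q * (1 - β + w q / u q - w p / u p) ^ 2 +
      (T p q - A p q) * (-β + w q / u q - w p / u p) ^ 2) =
      (1 - 2 * β) * (v ⬝ᵥ (A *ᵥ u)) + 2 * (v ⬝ᵥ (A *ᵥ w)) - 2 * (a ⬝ᵥ (A *ᵥ u)) +
      β ^ 2 * (v ⬝ᵥ (T *ᵥ u)) - 2 * β * (v ⬝ᵥ (T *ᵥ w)) + 2 * β * (a ⬝ᵥ (T *ᵥ u)) +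
      v ⬝ᵥ (T *ᵥ d) + b ⬝ᵥ (T *ᵥ u) - 2 * (a ⬝ᵥ (T *ᵥ w)) := by
    simp only [dotProduct_mulVec_eq_sum, Finset.mul_sum, ← Finset.sum_add_distrib,
      ← Finset.sum_sub_distrib]
    refine Finset.sum_congr rfl fun p _ => Finset.sum_congr rfl fun q _ => ?_
    change v p * u q * (A p q * (1 - β + h q - h p) ^ 2 +
      (T p q - A p q) * (-β + h q - h p) ^ 2) = _
    rw [hw' q]
    simp only [ha, hb, hd]
    ring
  rw [key, hTx, hTx, hTx, hxT, hxT, hau, hbu, hvu, hvw]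
  linear_combination (1 - 2 * β) * e1 - 2 * e2

/-- If the increments of a counting function are coboundary perturbations of the constant `β`,
then so are the counts along all paths. -/
theorem exists_int_of_pow_pos {h : Fin m → ℝ} (hT0 : ∀ p q, 0 ≤ T p q)
    (hA : ∀ p q, A p q ≠ 0 → 1 - β + h q - h p = 0)
    (hB : ∀ p q, T p q - A p q ≠ 0 → -β + h q - h p = 0) (n : ℕ) (p q : Fin m)
    (hpq : 0 < (T ^ n) p q) : ∃ a : ℤ, (a : ℝ) - n * β + h q - h p = 0 := by
  induction n generalizing q with
  | zero =>
    have : p = q := by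
      by_contra hne
      simp [Matrix.one_apply_ne hne] at hpq
    exact ⟨0, by simp [this]⟩
  | succ n ih =>
    rw [pow_succ, Matrix.mul_apply] at hpq
    obtain ⟨s, -, hs⟩ := Finset.exists_ne_zero_of_sum_ne_zero hpq.ne'
    obtain ⟨h1, h2⟩ := mul_ne_zero_iff.1 hs
    obtain ⟨a, ha⟩ := ih s (lt_of_le_of_ne (Matrix.pow_apply_nonneg hT0 n p s) (Ne.symm h1))
    by_cases h3 : A s q = 0
    · refine ⟨a, ?_⟩
      have := hB s q (by rwa [h3, sub_zero])
      push_cast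
      linarith
    · refine ⟨a + 1, ?_⟩
      have := hA s q h3
      push_cast
      linarith

/-- Along a closed path the coboundary telescopes to zero, so its length times `β` is an integer.
Closed paths at state `0` of lengths `k` and `k + 1` make `β` an integer. -/
theorem not_coboundary [NeZero m] (hT : T.IsPrimitive) {h : Fin m → ℝ} (hβ0 : 0 < β)
    (hβ1 : β < 1) (hA : ∀ p q, A p q ≠ 0 → 1 - β + h q - h p = 0)
    (hB : ∀ p q, T p q - A p q ≠ 0 → -β + h q - h p = 0) : False := by
  obtain ⟨c, hc, u, hu, hTu⟩ := exists_pos_eigenvector (isPrimitive_transpose hT)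
  obtain ⟨hT0, k, -, hk⟩ := hT
  -- A positive left eigenvector with positive eigenvalue rules out a zero column; then `T ^ k` maps
  -- column `0` of `T` to a positive vector.
  have hcol : T *ᵥ Pi.single 0 1 ≠ 0 := by
    intro h0
    have h1 : u ⬝ᵥ (T *ᵥ Pi.single 0 1) = c * u 0 := by
      rw [Matrix.dotProduct_mulVec, ← Matrix.mulVec_transpose, hTu]
      simp
    rw [h0, dotProduct_zero] at h1
    exact (mul_pos hc (hu 0)).ne h1
  have hk1 : 0 < (T ^ (k + 1)) 0 0 := by
    have := mulVec_pos hk (x := T *ᵥ Pi.single 0 1) (fun p => by simpa using hT0 p 0) hcol 0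
    rw [Matrix.mulVec_mulVec, ← pow_succ] at this
    simpa using this
  obtain ⟨a, ha⟩ := exists_int_of_pow_pos hT0 hA hB k 0 0 (hk 0 0)
  obtain ⟨a', ha'⟩ := exists_int_of_pow_pos hT0 hA hB (k + 1) 0 0 hk1
  have hβ : ((a' - a : ℤ) : ℝ) = β := by
    push_cast at ha' ⊢
    linarith
  rw [← hβ] at hβ0 hβ1
  have h1 : 0 < a' - a := by exact_mod_cast hβ0
  have h2 : a' - a < 1 := by exact_mod_cast hβ1
  omega

/-- If the weighted sum of squares vanished, each increment of positive weight would be zero, which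
`not_coboundary` forbids. -/
theorem variance_pos [NeZero m] (hT : T.IsPrimitive) (hA0 : ∀ p q, 0 ≤ A p q)
    (hAT : ∀ p q, A p q ≤ T p q) (hβ0 : 0 < β) (hβ1 : β < 1) (hu : ∀ p, 0 < u p)
    (hv : ∀ p, 0 < v p) (hTu : T *ᵥ u = lam • u) (hTv : v ᵥ* T = lam • v)
    (hvu : v ⬝ᵥ u = 1) (hvw : v ⬝ᵥ w = 0)
    (hw : A *ᵥ u + T *ᵥ w = (lam * β) • u + lam • w) :
    0 < lam * β + 2 * (v ⬝ᵥ (A *ᵥ w)) - lam * β ^ 2 := by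
  rw [← sum_sq_increments hu hTu hTv hvu hvw hw]
  have hA1 : ∀ p q, 0 ≤ A p q * (1 - β + w q / u q - w p / u p) ^ 2 := fun p q =>
    mul_nonneg (hA0 p q) (sq_nonneg _)
  have hB1 : ∀ p q, 0 ≤ (T p q - A p q) * (-β + w q / u q - w p / u p) ^ 2 := fun p q =>
    mul_nonneg (sub_nonneg.2 (hAT p q)) (sq_nonneg _)
  have hnn : ∀ p q, 0 ≤ v p * u q * (A p q * (1 - β + w q / u q - w p / u p) ^ 2 +
      (T p q - A p q) * (-β + w q / u q - w p / u p) ^ 2) := fun p q =>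
    mul_nonneg (mul_pos (hv p) (hu q)).le (add_nonneg (hA1 p q) (hB1 p q))
  refine lt_of_le_of_ne (Finset.sum_nonneg fun p _ => Finset.sum_nonneg fun q _ => hnn p q)
    fun h0 => ?_
  have hzero : ∀ p q, A p q * (1 - β + w q / u q - w p / u p) ^ 2 = 0 ∧
      (T p q - A p q) * (-β + w q / u q - w p / u p) ^ 2 = 0 := fun p q => by
    have h1 := (Finset.sum_eq_zero_iff_of_nonneg fun p _ =>
      Finset.sum_nonneg fun q _ => hnn p q).1 h0.symm p (Finset.mem_univ p)
    have h2 := (Finset.sum_eq_zero_iff_of_nonneg fun q _ => hnn p q).1 h1 q (Finset.mem_univ q)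
    exact (add_eq_zero_iff_of_nonneg (hA1 p q) (hB1 p q)).1
      ((mul_eq_zero.1 h2).resolve_left (mul_pos (hv p) (hu q)).ne')
  exact not_coboundary (A := A) (h := fun p => w p / u p) hT hβ0 hβ1
    (fun p q hpq => pow_eq_zero_iff two_ne_zero |>.1
      ((mul_eq_zero.1 (hzero p q).1).resolve_left hpq))
    (fun p q hpq => pow_eq_zero_iff two_ne_zero |>.1
      ((mul_eq_zero.1 (hzero p q).2).resolve_left hpq))

end Variance

/-! ### The entries of `Γ`. -/

namespace LinearRepresentation

variable {ℓ m : ℕ} (R : LinearRepresentation ℓ m)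

theorem A_le_M (i : Fin ℓ) (p q : Fin m) : R.A i p q ≤ R.M p q := by
  rw [M, Matrix.add_apply, Matrix.sum_apply]
  have := Finset.single_le_sum (f := fun j => R.A j p q) (fun j _ => R.A_nonneg j p q)
    (Finset.mem_univ i)
  linarith [R.B_nonneg p q]

variable [NeZero m] {u v : (Fin ℓ → ℝ) → Fin m → ℝ}
  (hM : R.M.IsPrimitive) (huv : ∀ t, IsPerronPair (R.Mt t) (u t) (v t))

include hM huv in
theorem Γ_eq (i j : Fin ℓ) : R.Γ i j =
    partialDeriv i (partialDeriv j R.y) 0 / perronRoot R.M -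
      partialDeriv i R.y 0 * partialDeriv j R.y 0 / perronRoot R.M ^ 2 := by
  rw [Γ, hessian_log i j (R.contDiff_y_normalizedRight hM huv).1 fun t => (R.y_pos hM t).ne',
    y_zero]

-- The product `λ γ_ii` is the expression of `variance_pos` for `A = A_i` and `w` the derivative of
-- the normalized right eigenvector.
include hM huv in
theorem Γ_self_pos (i : Fin ℓ) : 0 < R.Γ i i := by
  have hpos := R.perronRoot_pos hM
  have hy : partialDeriv i R.y 0 = perronRoot R.M * R.β i := by
    rw [β, mul_div_cancel₀ _ hpos.ne']
  have h := variance_pos hM (R.A_nonneg i) (R.A_le_M i) (R.β_pos hM huv i) (R.β_lt_one hM huv i)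
    (huv 0).right_pos (huv 0).left_pos (R.M_mulVec huv) (R.vecMul_M huv) (huv 0).normalized
    (R.dotProduct_deriv_normalizedRight hM huv i) (hy ▸ R.deriv_eigen_zero hM huv i)
  have h2 := div_pos h hpos
  rw [R.Γ_eq hM huv, R.partialDeriv_partialDeriv_y hM huv, hy]
  refine h2.trans_eq ?_
  field_simp

end LinearRepresentation

/-! ### From exponentially small errors to the stated asymptotics. -/

theorem expSmall_finite {ι : Type*} [Finite ι] {a : ι → ℕ → ℝ} (h : ∀ k, ExpSmall (a k)) :
    ∃ ε : ℝ, 0 < ε ∧ ε < 1 ∧ ∀ k, a k =O[atTop] fun n : ℕ => ε ^ n := by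
  choose e h0 h1 h2 using h
  rcases isEmpty_or_nonempty ι with hι | hι
  · exact ⟨1 / 2, by norm_num, by norm_num, fun k => hι.elim k⟩
  · obtain ⟨k₀, hk₀⟩ := Finite.exists_max e
    exact ⟨e k₀, h0 k₀, h1 k₀, fun k => isBigO_pow_of_le (h0 k) (hk₀ k) (h2 k)⟩

theorem ExpSmall.tendsto_div {a : ℕ → ℝ} {g c : ℝ} (h : ExpSmall fun n => a n - (n * g + c)) :
    Tendsto (fun n : ℕ => a n / n) atTop (𝓝 g) := by
  have h1 : Tendsto (fun n : ℕ => (a n - (n * g + c) + c) * (n : ℝ)⁻¹ + g) atTop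
      (𝓝 ((0 + c) * 0 + g)) :=
    ((h.tendsto.add_const c).mul tendsto_inv_atTop_nhds_zero_nat).add_const g
  simp only [mul_zero, zero_add] at h1
  refine h1.congr' ((eventually_gt_atTop 0).mono fun n hn => ?_)
  have : (n : ℝ) ≠ 0 := by exact_mod_cast hn.ne'
  field_simp
  ring

theorem isTheta_of_tendsto_div {a : ℕ → ℝ} {g : ℝ} (hg : g ≠ 0)
    (h : Tendsto (fun n : ℕ => a n / n) atTop (𝓝 g)) : a =Θ[atTop] fun n : ℕ => (n : ℝ) := by
  have h1 : (fun n : ℕ => a n / n) =Θ[atTop] fun _ => (1 : ℝ) :=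
    ((isEquivalent_const_iff_tendsto hg).2 h).isTheta.trans
      ((isTheta_const_const_iff).2 (iff_of_false hg one_ne_zero))
  have h2 : a =ᶠ[atTop] fun n : ℕ => a n / n * n := by
    filter_upwards [eventually_gt_atTop 0] with n hn
    exact (div_mul_cancel₀ _ (by exact_mod_cast hn.ne')).symm
  simpa only [one_mul] using h2.trans_isTheta (h1.mul (isTheta_refl (fun n : ℕ => (n : ℝ)) atTop))

end RationalModel

theorem mainTheorem2 {ℓ m : ℕ} (hℓ : 0 < ℓ) (R : RationalModel.LinearRepresentation ℓ m)
    (hr : ∀ᶠ n : ℕ in atTop, ∃ w : RationalModel.Word ℓ n, 0 < R.series w)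
    (hM : R.M.IsPrimitive) :
    -- `y` is the positive analytic solution of `det (y(t) I - M(t)) = 0`, `y(0)` being the
    -- Perron-Frobenius eigenvalue of `M`
    R.y 0 = RationalModel.perronRoot R.M ∧
    (∀ t, 0 < R.y t) ∧
    (∀ t, (R.y t • (1 : Matrix (Fin m) (Fin m) ℝ) - R.Mt t).det = 0) ∧
    AnalyticOnNhd ℝ R.y Set.univ ∧
    -- normalized positive eigenvectors of all the matrices `M(t)` exist
    (∃ u v : (Fin ℓ → ℝ) → Fin m → ℝ, ∀ t, RationalModel.IsPerronPair (R.Mt t) (u t) (v t)) ∧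
    -- and for every choice of them the following holds
    ∀ u v : (Fin ℓ → ℝ) → Fin m → ℝ,
      (∀ t, RationalModel.IsPerronPair (R.Mt t) (u t) (v t)) →
      (∀ t, 0 < R.r u v t) ∧ R.r u v 0 = 1 ∧ AnalyticOnNhd ℝ (R.r u v) Set.univ ∧
      -- the vector `β`
      (∀ i, R.β i = (v 0 ⬝ᵥ (R.A i *ᵥ u 0)) / RationalModel.perronRoot R.M) ∧
      (∀ i, 0 < R.β i ∧ R.β i < 1) ∧ 0 < ∑ i, R.β i ∧ ∑ i, R.β i < 1 ∧
      -- entries of `Γ` and `C`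
      (∀ i j, R.Γ i j =
        RationalModel.partialDeriv i (RationalModel.partialDeriv j R.y) 0
            / RationalModel.perronRoot R.M
          - RationalModel.partialDeriv i R.y 0 * RationalModel.partialDeriv j R.y 0
            / RationalModel.perronRoot R.M ^ 2) ∧
      (∀ i j, R.C u v i j =
        RationalModel.partialDeriv i (RationalModel.partialDeriv j (R.r u v)) 0
          - RationalModel.partialDeriv i (R.r u v) 0
            * RationalModel.partialDeriv j (R.r u v) 0) ∧
      (∀ i, 0 < R.Γ i i) ∧
      -- mean values and covariances
      (∃ ε : ℝ, 0 < ε ∧ ε < 1 ∧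
        (∀ i, (fun n : ℕ => (∫ w, R.Y n i w ∂(R.wordMeasure n)) - (n * R.β i + R.c u v i))
          =O[atTop] fun n : ℕ => ε ^ n) ∧
        (∀ i j, (fun n : ℕ => cov[R.Y n i, R.Y n j; R.wordMeasure n]
            - (n * R.Γ i j + R.C u v i j))
          =O[atTop] fun n : ℕ => ε ^ n)) ∧
      (∀ i, (fun n : ℕ => Var[R.Y n i; R.wordMeasure n]) =Θ[atTop] fun n : ℕ => (n : ℝ)) ∧
      (∀ i j, Tendsto
        (fun n : ℕ => cov[fun w => R.Y n i w / √(n : ℝ), fun w => R.Y n j w / √(n : ℝ);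
          R.wordMeasure n])
        atTop (𝓝 (R.Γ i j))) := by
  have := R.neZero hℓ
  -- One word of positive weight shows `ξ ≠ 0` and `η ≠ 0`, hence `ξ'u_t v_t'η > 0` for all `t`.
  obtain ⟨n₀, w₀, hw₀⟩ := hr.exists
  have hξ := R.ξ_ne_zero hw₀
  have hη := R.η_ne_zero hw₀
  obtain ⟨u₀, v₀, huv₀⟩ := R.exists_perronPairs hM
  refine ⟨R.y_zero, R.y_pos hM, R.det_eq_zero hM,
    contDiff_omega_iff_analyticOnNhd.1 (R.contDiff_y_normalizedRight hM huv₀).1,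
    ⟨u₀, v₀, huv₀⟩, fun u v huv => ?_⟩
  obtain ⟨hmean, hcov⟩ := R.expSmall_genFun hM huv hξ hη
  replace hmean : ∀ i, RationalModel.ExpSmall fun n =>
      (∫ w, R.Y n i w ∂(R.wordMeasure n)) - (n * R.β i + R.c u v i) := fun i =>
    (hmean i).congr (Eventually.of_forall fun n => by beta_reduce; rw [R.integral_Y])
  -- The moment formula for the covariance needs a probability measure, which is available only for
  -- large `n`; this suffices for an asymptotic statement.
  replace hcov : ∀ i j, RationalModel.ExpSmall fun n =>
      cov[R.Y n i, R.Y n j; R.wordMeasure n] - (n * R.Γ i j + R.C u v i j) := fun i j =>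
    (hcov i j).congr (hr.mono fun n hn => by beta_reduce; rw [R.covariance_Y hn])
  have hlim := fun i j => (hcov i j).tendsto_div
  have : Nonempty (Fin ℓ) := ⟨⟨0, hℓ⟩⟩
  refine ⟨R.r_pos huv hξ hη, R.r_zero huv hξ hη,
    contDiff_omega_iff_analyticOnNhd.1 (R.contDiff_r hM huv), R.β_eq hM huv,
    fun i => ⟨R.β_pos hM huv i, R.β_lt_one hM huv i⟩,
    Finset.sum_pos (fun i _ => R.β_pos hM huv i) Finset.univ_nonempty, R.sum_β_lt_one hM huv,
    R.Γ_eq hM huv, fun i j => ?_, R.Γ_self_pos hM huv, ?_, fun i => ?_, fun i j => ?_⟩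
  · rw [RationalModel.LinearRepresentation.C, RationalModel.hessian_log i j (R.contDiff_r hM huv)
      fun t => (R.r_pos huv hξ hη t).ne', R.r_zero huv hξ hη]
    ring
  · obtain ⟨ε₁, h0, h1, h2⟩ := RationalModel.expSmall_finite hmean
    obtain ⟨ε₂, h0', h1', h2'⟩ := RationalModel.expSmall_finite
      (a := fun k : Fin ℓ × Fin ℓ => fun n : ℕ =>
        cov[R.Y n k.1, R.Y n k.2; R.wordMeasure n] - (n * R.Γ k.1 k.2 + R.C u v k.1 k.2))
      fun k => hcov k.1 k.2
    exact ⟨max ε₁ ε₂, lt_max_of_lt_left h0, max_lt h1 h1',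
      fun i => RationalModel.isBigO_pow_of_le h0 (le_max_left _ _) (h2 i),
      fun i j => RationalModel.isBigO_pow_of_le h0' (le_max_right _ _) (h2' (i, j))⟩
  · refine RationalModel.isTheta_of_tendsto_div (R.Γ_self_pos hM huv i).ne' ?_
    refine (hlim i i).congr fun n => ?_
    rw [covariance_self (measurable_from_top.aemeasurable)]
  · refine (hlim i j).congr fun n => ?_
    simp only [div_eq_mul_inv]
    rw [covariance_mul_const_left, covariance_mul_const_right, mul_assoc, ← mul_inv,
      Real.mul_self_sqrt (Nat.cast_nonneg n)]
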